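/- **Setting.** Let $V$ be a real Hilbert space (a complex one is regarded as a real one), $\mathcal L$ a bounded skew-adjoint operator on $V$, $\varepsilon>0$, and $\mathcal N:V\to V$. Put $N(\tau,w)=e^{\tau\mathcal L}\mathcal N(e^{-\tau\mathcal L}w)$. The modulation equation is $w'(t)=N(t/\varepsilon,w(t))$. For a kernel $\rho\ge 0$ on $[-\tfrac12,\tfrac12]$ with $\int\rho=1$ and windows $\eta_l>0$ (measured in the fast time $t/\varepsilon$), the averaged equation of level $l$ is $$\bar w'(t)=\frac1{\eta_l}\int_{-\eta_l/2}^{\eta_l/2}\rho\Big(\frac s{\eta_l}\Big)N\Big(\frac t\varepsilon+s,\bar w(t)\Big)\,ds .$$ Let $D\subset V$ be open, convex and invariant under all $e^{\tau\mathcal L}$, let $\mathcal N$ be $C^2$ on $D$ with $\|\mathcal N\|,\|D\mathcal N\|,\|D^2\mathcal N\|\le M$ on $D$, and let $S\subset V$ be a set of states such that from every $x\in S$ and every start time $t\in[0,T]$ both equations are solvable in $D$ up to time $T$ (for instance $S=D=V$). Let $E(t,h,x)$ and $\bar E^l(t,h,x)$ be the values at time $t+h$ of the solutions of the modulation equation and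 of the averaged equation of level $l$ that start from $x$ at time $t$. **Method.** Levels are $0,\dots,L-1$ (fine to coarse), with time-steps $\Delta T_l=N^l\Delta T_0$, $\Delta T_0>0$, coarsening factor $N\ge1$, and $N\Delta T_{L-1}=T$. On level $0$ a one-step scheme $G^0$ for the modulation equation is given, on level $l\ge1$ a one-step scheme $\bar G^l$ for the averaged equation of level $l$. Let $P^0$ be $N$ serial steps of $G^0$. For $l\ge1$, an interval $[t,t+N\Delta T_l]$, $T_n=t+n\Delta T_l$ and initial value $x$, define $U_{0}^{k}=x$, $$U_{n+1}^{0}=\bar G^l(T_n,U_n^0),\qquad U_{n+1}^{k+1}=\bar G^l(T_n,U_n^{k+1})+P^{l-1}(T_n,U_n^k)-\bar G^l(T_n,U_n^k),$$ and let $P^l(t,x)=U_N^{k_l}$, where $k_l$ is the number of iterations on level $l$. The error on level $l$ is $e_{n,l}^{k_l}=\|E(t,n\Delta T_l,x)-U_n^{k_l}\|$. **Assumptions on the schemes** (for states in $S$ and all steps inside $[0,T]$). For $l=1,\dots,L-1$: 1. $\bar E^l(t,\Delta T_l,x)-\bar G^l(t,x)$ has norm at most $\bar C_1^l\Delta T_l^{p_c+1}$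 and an expansion $\bar c^{\,l}_{p_c+1}(t,x)\Delta T_l^{p_c+1}+\bar c^{\,l}_{p_c+2}(t,x)\Delta T_l^{p_c+2}+\cdots$ whose coefficients $\bar c^{\,l}_{p_c+1+j}$ are Lipschitz in $x$ with constants $\lambda_j$, $\sum_{j\ge 0}\lambda_j\Delta T_l^j\le\bar C_1^l$; 2. $\|\bar G^l(t,x)-\bar G^l(t,y)\|\le(1+C_{2,l}\Delta T_l)\|x-y\|$, $C_{2,l}\ge0$; 3. $\bar C_1^l\le C_1K_l$ with $K_l=\max_{\omega_0\le\omega}\{|\varepsilon/\omega|\,\kappa(\varepsilon,\eta_l,\omega)\}$ (a supremum, assumed finite), where $\omega_0>0$ and $\kappa\ge0$ is the function that describes the dependence of the truncation error constants on $\varepsilon$ and $\eta_l$. Moreover $\|E(t,\Delta T_0,x)-G^0(t,x)\|\le c\,\Delta T_0^{p_0+1}$, $c\ge 0$. **Theorem.** There is a constant $C>0$, depending only on $M$, $T$, $C_1$ (and $V$), such that in every such situation the following holds. Put $\mathcal M_{1,l}=E-\bar E^l$ and $\mathcal M_{0,l}=\bar E^l-\bar G^l$ (over one step $\Delta T_l$),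 let $\|\tilde{\mathcal M}_1\|$ be the supremum of $\|\mathcal M_{1,l}(t,x)\|/(\eta_l\varepsilon)$ and $\|\tilde{\mathcal M}_0\|$ that of $\|\mathcal M_{0,l}(t,x)\|/(\Delta T_l^{p_c+1}K_l)$ over $1\le l\le L-1$, $x\in S$ and admissible $t$ (with $0/0=0$), and $$\bar\alpha_l=C\eta_l\varepsilon+C\Delta T_l^{p_c+1}K_l,\qquad \beta_l=1+C_{2,l}\Delta T_l,\qquad \bar\gamma_l=C\eta_l\varepsilon\|\tilde{\mathcal M}_1\|+C\Delta T_l^{p_c+1}K_l\|\tilde{\mathcal M}_0\| .$$ Then $$\|\mathcal M_{1,l}(t,x)\|\le C\eta_l\varepsilon,\qquad \|\mathcal M_{1,l}(t,x)-\mathcal M_{1,l}(t,y)\|\le C\eta_l\varepsilon\|x-y\|\qquad(x,y\in S),$$ and there are $\bar\alpha_{0N,l}\in[0,\bar\alpha_l]$ with $(1+\bar\alpha_l)^N-1=N\bar\alpha_l(1+\bar\alpha_{0N,l})^{N-1}$ such that, for every $1\le l\le L-1$, every $t\ge0$ with $t+N\Delta T_l\le T$, every $x$ for which all exact and numerical states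 occurring at the grid points in the run of the method from $(t,x)$, on level $l$ and on the finer levels, lie in $S$, and every $0\le n\le N$, $$e_{n,l}^{k_l}\le\sum_{\bar l=1}^{l}\bar E_{\bar l}\prod_{j=\bar l+1}^{l}A_j+\delta_0\prod_{\bar l=1}^{l}A_{\bar l},$$ where $$\bar E_{\bar l}=\binom{n_{\bar l}}{k_{\bar l}+1}\bar\gamma_{\bar l}\,\bar\alpha_{\bar l}^{\,k_{\bar l}}\beta_{\bar l}^{\,N-k_{\bar l}-1},\quad n_l=n,\ n_{\bar l}=N\text{ for }\bar l<l,\qquad A_j=N\beta_j^{N-1}(1+\bar\alpha_{0N,j})^{N-1},\qquad \delta_0=C\,c\,\Delta T_1\Delta T_0^{p_0}$$ (and $\bar E_{\bar l}=0$ if $k_{\bar l}\ge n_{\bar l}$). -/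

import Mathlib

noncomputable section

namespace MLParareal

open Set MeasureTheory

/-! ### The modulation equation and its averages -/

section Equations

variable {V : Type*} [NormedAddCommGroup V] [InnerProductSpace ℝ V] [CompleteSpace V]

/-- The modulated nonlinearity `exp(τ ℒ) 𝒩 (exp(-τ ℒ) w)` at the fast time `τ`. -/
def modulated (Lop : V →L[ℝ] V) (Nl : V → V) (τ : ℝ) (w : V) : V :=
  NormedSpace.exp (τ • Lop) (Nl (NormedSpace.exp (-(τ • Lop)) w))

/-- Right-hand side of the modulation equation `w' = exp(tℒ/ε) 𝒩 (exp(-tℒ/ε) w)`. -/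
def modulationRHS (Lop : V →L[ℝ] V) (Nl : V → V) (ε : ℝ) (t : ℝ) (w : V) : V :=
  modulated Lop Nl (t / ε) w

/-- Right-hand side of the averaged equation with kernel `ρ` and window `η`,
`w' = (1/η) ∫_{-η/2}^{η/2} ρ(s/η) exp((t/ε+s)ℒ) 𝒩 (exp(-(t/ε+s)ℒ) w) ds`.
The window is measured in the fast time `t/ε`. -/
def averagedRHS (Lop : V →L[ℝ] V) (Nl : V → V) (ε : ℝ) (ρ : ℝ → ℝ) (η : ℝ)
    (t : ℝ) (w : V) : V :=
  (1 / η) • ∫ s in (-(η / 2))..(η / 2), ρ (s / η) • modulated Lop Nl (t / ε + s) w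

/-- A normalized nonnegative averaging kernel on `[-1/2, 1/2]`. -/
structure IsKernel (ρ : ℝ → ℝ) : Prop where
  nonneg : ∀ s ∈ Icc (-(1 / 2) : ℝ) (1 / 2), 0 ≤ ρ s
  integrable : IntervalIntegrable ρ volume (-(1 / 2)) (1 / 2)
  integral_eq_one : ∫ s in (-(1 / 2) : ℝ)..(1 / 2), ρ s = 1

/-- `w` solves `w' = f(s, w)` on `[t, b]` with `w t = x` and stays in the region `D`. -/
def IsSolution (f : ℝ → V → V) (D : Set V) (t b : ℝ) (x : V) (w : ℝ → V) : Prop :=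
  w t = x ∧ ∀ s ∈ Icc t b, w s ∈ D ∧ HasDerivWithinAt w (f s (w s)) (Icc t b) s

open Classical in
/-- The exact propagator of `w' = f(s, w)`: the value at time `t + h` of the solution in `D`
on `[t, b]` that starts at time `t` in `x` (and `x` if there is no such solution). -/
def exactProp (f : ℝ → V → V) (D : Set V) (b t h : ℝ) (x : V) : V :=
  if H : ∃ w, IsSolution f D t b x w then H.choose (t + h) else x

end Equations

/-! ### The algorithm -/

section Algorithm

variable {V : Type*} [NormedAddCommGroup V]

/-- `n` serial steps of size `h` with the one-step method `g`, from `x` at time `t`. -/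
def serialSteps (g : ℝ → V → V) (h t : ℝ) (x : V) : ℕ → V
  | 0 => x
  | n + 1 => g (t + n * h) (serialSteps g h t x n)

/-- The Parareal iterates `U_n^k` (`k` iterations, `n` steps of size `h`, started from `x` at
time `t`) with coarse propagator `G` and fine propagator `F`. -/
def iterate (G F : ℝ → V → V) (h t : ℝ) (x : V) : ℕ → ℕ → V
  | _, 0 => x
  | 0, n + 1 => G (t + n * h) (iterate G F h t x 0 n)
  | k + 1, n + 1 =>
      G (t + n * h) (iterate G F h t x (k + 1) n)
        + F (t + n * h) (iterate G F h t x k n)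
        - G (t + n * h) (iterate G F h t x k n)

end Algorithm

/-- The data of a multi-level Parareal method with averaging. -/
structure Data (V : Type*) [NormedAddCommGroup V] [InnerProductSpace ℝ V] where
  /-- the linear operator `ℒ` -/
  Lop : V →L[ℝ] V
  /-- the nonlinearity `𝒩` -/
  Nl : V → V
  /-- the scale separation parameter -/
  ε : ℝ
  /-- the averaging kernel -/
  ρ : ℝ → ℝ
  /-- the averaging window on each level -/
  η : ℕ → ℝ
  /-- the end of the time interval `[0, T]` -/
  T : ℝ
  /-- a region of the state space in which exact solutions evolve -/
  D : Set V
  /-- the set of states at which the propagators are compared -/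
  S : Set V
  /-- the number of levels; they are numbered `0, …, L - 1` from fine to coarse -/
  L : ℕ
  /-- the coarsening factor -/
  N : ℕ
  /-- the time-step on level `0` -/
  dt : ℝ
  /-- the number of Parareal iterations on each level -/
  k : ℕ → ℕ
  /-- one step of the numerical scheme on each level: `G l t x` starts from `x` at time `t` and
  advances by the time-step of level `l` -/
  G : ℕ → ℝ → V → V
  /-- the order of the schemes on the levels `1, …, L - 1` -/
  p : ℕ
  /-- the order of the scheme on level `0` -/
  p₀ : ℕ
  /-- the truncation error constant of level `0` -/
  c : ℝ
  /-- the truncation error constants of the levels `1, …, L - 1` -/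
  Cbar : ℕ → ℝ
  /-- the stability constants of the levels `1, …, L - 1` -/
  C₂ : ℕ → ℝ
  /-- the least frequency -/
  ω₀ : ℝ
  /-- the function `κ(ε, η, ω)` -/
  κ : ℝ → ℝ → ℝ → ℝ

namespace Data

variable {V : Type*} [NormedAddCommGroup V] [InnerProductSpace ℝ V]

/-- The time-step `ΔT_l = N^l ΔT_0`. -/
def step (d : Data V) (l : ℕ) : ℝ := (d.N : ℝ) ^ l * d.dt

/-- The propagators `P^l`, advancing by `N ΔT_l = ΔT_{l+1}`: on level `0`, `N` serial steps of the
basic scheme; on level `l + 1`, Parareal with coarse propagator `G^{l+1}`, fine propagator `P^l`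
and `k_{l+1}` iterations. -/
def P (d : Data V) : ℕ → ℝ → V → V
  | 0 => fun t x => serialSteps (d.G 0) (d.step 0) t x d.N
  | l + 1 => fun t x =>
      iterate (d.G (l + 1)) (P d l) (d.step (l + 1)) t x (d.k (l + 1)) d.N

/-- The iterates `U_n^j` of level `l ≥ 1` on the interval `[t, t + N ΔT_l]`, started from `x`. -/
def U (d : Data V) (l : ℕ) (t : ℝ) (x : V) (j n : ℕ) : V :=
  iterate (d.G l) (d.P (l - 1)) (d.step l) t x j n

/-- `max_{ω ≥ ω₀} |ε/ω| κ(ε, η_l, ω)`. -/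
def K (d : Data V) (l : ℕ) : ℝ :=
  sSup ((fun ω => |d.ε / ω| * d.κ d.ε (d.η l) ω) '' Ici d.ω₀)

variable [CompleteSpace V]

/-- The exact propagator `E` of the modulation equation. -/
def E (d : Data V) (t h : ℝ) (x : V) : V :=
  exactProp (modulationRHS d.Lop d.Nl d.ε) d.D d.T t h x

/-- The exact propagator `Ē^l` of the averaged equation of level `l`. -/
def Ebar (d : Data V) (l : ℕ) (t h : ℝ) (x : V) : V :=
  exactProp (averagedRHS d.Lop d.Nl d.ε d.ρ (d.η l)) d.D d.T t h x

/-- The averaging error `ℳ_{1,l} = E - Ē^l` over one step of level `l`. -/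
def M1 (d : Data V) (l : ℕ) (t : ℝ) (x : V) : V :=
  d.E t (d.step l) x - d.Ebar l t (d.step l) x

/-- The truncation error `ℳ_{0,l} = Ē^l - Ḡ^l` over one step of level `l`. -/
def M0 (d : Data V) (l : ℕ) (t : ℝ) (x : V) : V :=
  d.Ebar l t (d.step l) x - d.G l t x

/-- The supremum, over the levels, start times and states, of `‖ℳ_{1,l}‖ / (ε η_l)`. -/
def normM1 (d : Data V) : ℝ :=
  sSup {r | ∃ l t x, 1 ≤ l ∧ l < d.L ∧ 0 ≤ t ∧ t + d.step l ≤ d.T ∧ x ∈ d.S ∧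
    r = ‖d.M1 l t x‖ / (d.η l * d.ε)}

/-- The supremum, over the levels, start times and states, of
`‖ℳ_{0,l}‖ / (ΔT_l^{p+1} max_ω |ε/ω| κ)`. -/
def normM0 (d : Data V) : ℝ :=
  sSup {r | ∃ l t x, 1 ≤ l ∧ l < d.L ∧ 0 ≤ t ∧ t + d.step l ≤ d.T ∧ x ∈ d.S ∧
    r = ‖d.M0 l t x‖ / (d.step l ^ (d.p + 1) * d.K l)}

/-- The truncation error of level `l`: it is at most `Cbar_l ΔT_l^{p+1}`, and it has an expansion
`c_{p+1}(x) ΔT_l^{p+1} + c_{p+2}(x) ΔT_l^{p+2} + …` whose coefficients are Lipschitz continuous in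
the state, with Lipschitz constants `lam_j` such that `∑_j lam_j ΔT_l^j ≤ Cbar_l`. -/
def TruncationError (d : Data V) (l : ℕ) : Prop :=
  (∀ t, 0 ≤ t → t + d.step l ≤ d.T → ∀ x ∈ d.S,
      ‖d.M0 l t x‖ ≤ d.Cbar l * d.step l ^ (d.p + 1)) ∧
  ∃ (coef : ℕ → ℝ → V → V) (lam : ℕ → ℝ),
    Summable (fun j => lam j * d.step l ^ j) ∧ ∑' j, lam j * d.step l ^ j ≤ d.Cbar l ∧
    ∀ t, 0 ≤ t → t + d.step l ≤ d.T →
      (∀ j, ∀ x ∈ d.S, ∀ y ∈ d.S, ‖coef j t x - coef j t y‖ ≤ lam j * ‖x - y‖) ∧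
      ∀ x ∈ d.S, HasSum (fun j => d.step l ^ (d.p + 1 + j) • coef j t x) (d.M0 l t x)

/-- All exact and numerical states that occur at the grid points when the method of level `l` is
run from `x` at time `t` (on this level and, recursively, on the finer ones) lie in `S`. -/
def RunIn (d : Data V) : ℕ → ℝ → V → Prop
  | 0 => fun t x => ∀ n < d.N, serialSteps (d.G 0) (d.step 0) t x n ∈ d.S
  | l + 1 => fun t x => ∀ n < d.N,
      d.E t (n * d.step (l + 1)) x ∈ d.S ∧
      (∀ j ≤ d.k (l + 1), d.U (l + 1) t x j n ∈ d.S) ∧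
      ∀ j < d.k (l + 1), RunIn d l (t + n * d.step (l + 1)) (d.U (l + 1) t x j n)

/-- The standing assumptions. `M` bounds the nonlinearity and its derivatives on the region `D`;
`C₁` is the factor with which `max_ω |ε/ω| κ(ε, η_l, ω)` controls the truncation error constants
of the schemes for the averaged equations. -/
structure Assumptions (d : Data V) (M C₁ : ℝ) : Prop where
  skew : ContinuousLinearMap.adjoint d.Lop = -d.Lop
  ε_pos : 0 < d.ε
  kernel : IsKernel d.ρ
  η_pos : ∀ l, 1 ≤ l → l < d.L → 0 < d.η l
  -- the region and the nonlinearity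
  D_open : IsOpen d.D
  D_convex : Convex ℝ d.D
  D_invariant : ∀ τ : ℝ, ∀ v ∈ d.D, NormedSpace.exp (τ • d.Lop) v ∈ d.D
  Nl_smooth : ContDiffOn ℝ 2 d.Nl d.D
  Nl_bound : ∀ v ∈ d.D, ‖d.Nl v‖ ≤ M
  Nl_bound' : ∀ v ∈ d.D, ‖fderiv ℝ d.Nl v‖ ≤ M
  Nl_bound'' : ∀ v ∈ d.D, ‖fderiv ℝ (fderiv ℝ d.Nl) v‖ ≤ M
  -- the exact and the averaged equations are solvable in `D` up to time `T` from states in `S`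
  solvable : ∀ t, 0 ≤ t → t ≤ d.T → ∀ x ∈ d.S,
    ∃ w, IsSolution (modulationRHS d.Lop d.Nl d.ε) d.D t d.T x w
  solvable_avg : ∀ l, 1 ≤ l → l < d.L → ∀ t, 0 ≤ t → t ≤ d.T → ∀ x ∈ d.S,
    ∃ w, IsSolution (averagedRHS d.Lop d.Nl d.ε d.ρ (d.η l)) d.D t d.T x w
  -- the grids: `N` steps on the coarsest level cover `[0, T]`
  N_pos : 1 ≤ d.N
  dt_pos : 0 < d.dt
  grid : (d.N : ℝ) ^ d.L * d.dt = d.T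
  -- the coarse schemes: truncation error and stability
  truncation : ∀ l, 1 ≤ l → l < d.L → d.TruncationError l
  C₂_nonneg : ∀ l, 1 ≤ l → l < d.L → 0 ≤ d.C₂ l
  stability : ∀ l, 1 ≤ l → l < d.L → ∀ t, 0 ≤ t → t + d.step l ≤ d.T →
    ∀ x ∈ d.S, ∀ y ∈ d.S, ‖d.G l t x - d.G l t y‖ ≤ (1 + d.C₂ l * d.step l) * ‖x - y‖
  -- dependence of the truncation error constants on `ε` and on the windows
  ω₀_pos : 0 < d.ω₀
  κ_nonneg : ∀ l, 1 ≤ l → l < d.L → ∀ ω, d.ω₀ ≤ ω → 0 ≤ d.κ d.ε (d.η l) ω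
  κ_bdd : ∀ l, 1 ≤ l → l < d.L →
    BddAbove ((fun ω => |d.ε / ω| * d.κ d.ε (d.η l) ω) '' Ici d.ω₀)
  Cbar_le : ∀ l, 1 ≤ l → l < d.L → d.Cbar l ≤ C₁ * d.K l
  -- the fine scheme: local truncation error
  c_nonneg : 0 ≤ d.c
  fine : ∀ t, 0 ≤ t → t + d.step 0 ≤ d.T → ∀ x ∈ d.S,
    ‖d.E t (d.step 0) x - d.G 0 t x‖ ≤ d.c * d.step 0 ^ (d.p₀ + 1)

/-! ### The quantities in the error bound -/

/-- `ᾱ_l`. -/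
def alpha (d : Data V) (C : ℝ) (l : ℕ) : ℝ :=
  C * d.η l * d.ε + C * d.step l ^ (d.p + 1) * d.K l

/-- `β_l`. -/
def beta (d : Data V) (l : ℕ) : ℝ := 1 + d.C₂ l * d.step l

/-- `γ̄_l`. -/
def gamma (d : Data V) (C : ℝ) (l : ℕ) : ℝ :=
  C * d.η l * d.ε * d.normM1 + C * d.step l ^ (d.p + 1) * d.K l * d.normM0

/-- `Ē_l`, the error emerging on level `l` after `n` steps. -/
def levelError (d : Data V) (C : ℝ) (l n : ℕ) : ℝ :=
  (n.choose (d.k l + 1) : ℝ) * d.gamma C l * d.alpha C l ^ d.k l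
    * d.beta l ^ (d.N - d.k l - 1)

/-- The amplification factor `A_l`. -/
def amp (d : Data V) (α₀ : ℕ → ℝ) (l : ℕ) : ℝ :=
  d.N * d.beta l ^ (d.N - 1) * (1 + α₀ l) ^ (d.N - 1)

/-- `δ_0`. -/
def delta0 (d : Data V) (C : ℝ) : ℝ := C * d.c * d.step 1 * d.step 0 ^ d.p₀

end Data

end MLParareal

end

/-! The proof has an analytic half, which compares the two equations, and a combinatorial half,
which solves the error recursion.

Averaging: in slow time the window has length `a = η_l ε`. The averaged field minus the original
one, `f̄ - f`, is the exact time derivative of the corrector `Φ(s,x) = ∬ aσ f(s + θaσ, x) dθ dν(σ)`.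
It satisfies `‖Φ‖, ‖DΦ‖ ≤ aM/2`, and `DΦ` is Lipschitz with the same constant. Adding `Φ(s,v)` to
the difference `w - v` of an exact and an averaged solution removes `f̄ - f` from its derivative,
and Grönwall gives `w - v = O(a)`. The same argument for the difference of two such differences
shows that the averaging error is `O(a)`-Lipschitz in the initial value (`norm_sub_averaged_le`,
`norm_averagingError_sub_le`). The linear flow is unitary, so the bounds `M` hold uniformly in `ε`;
derivatives of `f` in time, which may be of size `1/ε`, are never estimated.

Recursion: on each level, the Lipschitz bound for `E - G`, the stability of `G` and the error `δ` of
the finer propagator give `e (j+1) (n+1) ≤ α * e j n + β * e (j+1) n + δ`. Pascal's rule produces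
the binomial term, and `δ` is amplified by a geometric sum (`le_of_parareal_recursion`,
`norm_E_sub_U_le`). Inserting the bound of level `l` as the `δ` of level `l + 1` gives the sum of
products (`norm_E_sub_P_le`). -/

namespace MLParareal

open Set MeasureTheory

/-! ### Grönwall, second differences and tame vector fields -/

section Averaging

variable {V : Type*} [NormedAddCommGroup V] [NormedSpace ℝ V]

/-- Follows from `e^u - 1 ≤ u e^u`. This form has no division by `K`, so `K = 0` needs no separate
treatment later. -/
lemma gronwallBound_le {δ K ε x : ℝ} (hK : 0 ≤ K) (hε : 0 ≤ ε) :
    gronwallBound δ K ε x ≤ (δ + ε * x) * Real.exp (K * x) := by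
  rcases hK.eq_or_lt with rfl | hK
  · simp [gronwallBound_K0]
  · rw [gronwallBound_of_K_ne_0 hK.ne', add_mul]
    have h1 : Real.exp (K * x) - 1 ≤ K * x * Real.exp (K * x) := by
      have h2 := Real.add_one_le_exp (-(K * x))
      have h3 : Real.exp (-(K * x)) * Real.exp (K * x) = 1 := by
        rw [← Real.exp_add]; simp
      nlinarith [Real.exp_pos (K * x)]
    have h4 : ε / K * (Real.exp (K * x) - 1) ≤ ε / K * (K * x * Real.exp (K * x)) := by gcongr
    have h5 : ε / K * (K * x * Real.exp (K * x)) = ε * x * Real.exp (K * x) := by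
      field_simp
    simp only
    linarith

/-- Grönwall's inequality for a function with a one-sided derivative on a closed interval. -/
lemma norm_le_of_norm_hasDerivWithinAt_le {z z' : ℝ → V} {δ K ε t b : ℝ} (hK : 0 ≤ K)
    (hε : 0 ≤ ε) (hz : ∀ s ∈ Icc t b, HasDerivWithinAt z (z' s) (Icc t b) s)
    (h0 : ‖z t‖ ≤ δ) (hb : ∀ s ∈ Icc t b, ‖z' s‖ ≤ K * ‖z s‖ + ε) :
    ∀ s ∈ Icc t b, ‖z s‖ ≤ (δ + ε * (s - t)) * Real.exp (K * (s - t)) := by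
  intro s hs
  refine (norm_le_gronwallBound_of_norm_deriv_right_le
    (fun r hr => (hz r hr).continuousWithinAt) (fun r hr => ?_) h0
    (fun r hr => hb r (Ico_subset_Icc_self hr)) s hs).trans
    (gronwallBound_le hK hε)
  -- For `r < b` the interval `[t, b]` is a right neighbourhood of `r`, so the derivative within it
  -- is also the right derivative.
  refine (hz r (Ico_subset_Icc_self hr)).mono_of_mem_nhdsWithin ?_
  exact mem_nhdsWithin_iff_exists_mem_nhds_inter.2
    ⟨Iio b, Iio_mem_nhds hr.2, fun y hy => ⟨hr.1.trans hy.2, hy.1.le⟩⟩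

/-- The second difference of a function with bounded and Lipschitz continuous derivative. -/
lemma norm_second_difference_le {g : V → V} {D : Set V} {M R : ℝ} (hM : 0 ≤ M) (hD : IsOpen D)
    (hDc : Convex ℝ D) (hg : DifferentiableOn ℝ g D) (hb : ∀ x ∈ D, ‖fderiv ℝ g x‖ ≤ M)
    (hl : ∀ x ∈ D, ∀ y ∈ D, ‖fderiv ℝ g x - fderiv ℝ g y‖ ≤ M * ‖x - y‖)
    {a b c d : V} (ha : a ∈ D) (hb' : b ∈ D) (hc : c ∈ D) (hd : d ∈ D)
    (hac : ‖a - c‖ ≤ R) (hbd : ‖b - d‖ ≤ R) :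
    ‖(g a - g b) - (g c - g d)‖ ≤ M * ‖(a - b) - (c - d)‖ + M * R * ‖c - d‖ := by
  have key : ∀ p ∈ D, ∀ q ∈ D, ∀ θ ∈ Icc (0 : ℝ) 1, q + θ • (p - q) ∈ D ∧
      HasDerivWithinAt (fun θ : ℝ => g (q + θ • (p - q)))
        (fderiv ℝ g (q + θ • (p - q)) (p - q)) (Icc 0 1) θ := by
    intro p hp q hq θ hθ
    have hm : q + θ • (p - q) ∈ D := hDc.add_smul_sub_mem hq hp hθ
    refine ⟨hm, ?_⟩
    have h1 : HasDerivAt (fun θ : ℝ => q + θ • (p - q)) (p - q) θ := by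
      simpa using ((hasDerivAt_id θ).smul_const (p - q)).const_add q
    exact ((hg.differentiableAt (hD.mem_nhds hm)).hasFDerivAt.comp_hasDerivAt θ h1).hasDerivWithinAt
  -- Both segments, from `b` to `a` and from `d` to `c`, are traversed simultaneously. Points with
  -- equal parameter differ by a convex combination of `b - d` and `a - c`, hence by at most `R`.
  have := norm_image_sub_le_of_norm_deriv_le_segment_01'
    (f := fun θ : ℝ => g (b + θ • (a - b)) - g (d + θ • (c - d)))
    (C := M * ‖(a - b) - (c - d)‖ + M * R * ‖c - d‖)
    (fun θ hθ => (key a ha b hb' θ hθ).2.sub (key c hc d hd θ hθ).2) ?_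
  · convert! this using 2
    simp; abel
  · intro θ hθ'
    have hθ := Ico_subset_Icc_self hθ'
    have m1 := (key a ha b hb' θ hθ).1
    have m2 := (key c hc d hd θ hθ).1
    set A := fderiv ℝ g (b + θ • (a - b))
    set B := fderiv ℝ g (d + θ • (c - d))
    have e : A (a - b) - B (c - d) = A ((a - b) - (c - d)) + (A - B) (c - d) := by
      simp
    have hR : ‖(b + θ • (a - b)) - (d + θ • (c - d))‖ ≤ R := by
      have : (b + θ • (a - b)) - (d + θ • (c - d)) = (1 - θ) • (b - d) + θ • (a - c) := by
        module
      rw [this]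
      refine (norm_add_le _ _).trans ?_
      rw [norm_smul, norm_smul, Real.norm_of_nonneg hθ.1, Real.norm_of_nonneg (by linarith [hθ.2])]
      nlinarith [hθ.1, hθ.2]
    rw [e]
    refine (norm_add_le _ _).trans (add_le_add ?_ ?_)
    · exact (A.le_opNorm _).trans (by gcongr; exact hb _ m1)
    · refine ((A - B).le_opNorm _).trans ?_
      gcongr
      exact (hl _ m1 _ m2).trans (by gcongr)

/-- A time dependent vector field that is jointly `C¹`, bounded by `M`, and whose state derivative
is bounded by `M` and Lipschitz with constant `M` on the region `D`. -/
structure IsTame (f : ℝ → V → V) (D : Set V) (M : ℝ) : Prop where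
  nonneg : 0 ≤ M
  isOpen : IsOpen D
  convex : Convex ℝ D
  smooth : ContDiffOn ℝ 1 (fun p : ℝ × V => f p.1 p.2) (univ ×ˢ D)
  bound : ∀ s, ∀ x ∈ D, ‖f s x‖ ≤ M
  bound_fderiv : ∀ s, ∀ x ∈ D, ‖fderiv ℝ (f s) x‖ ≤ M
  lip_fderiv : ∀ s, ∀ x ∈ D, ∀ y ∈ D, ‖fderiv ℝ (f s) x - fderiv ℝ (f s) y‖ ≤ M * ‖x - y‖

namespace IsTame

variable {f : ℝ → V → V} {D : Set V} {M : ℝ}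

lemma hasFDerivAt (h : IsTame f D M) (s : ℝ) {x : V} (hx : x ∈ D) :
    HasFDerivAt (fun p : ℝ × V => f p.1 p.2) (fderiv ℝ (fun p : ℝ × V => f p.1 p.2) (s, x)) (s, x) :=
  ((h.smooth.differentiableOn one_ne_zero).differentiableAt
    ((isOpen_univ.prod h.isOpen).mem_nhds ⟨mem_univ _, hx⟩)).hasFDerivAt

lemma hasFDerivAt_state (h : IsTame f D M) (s : ℝ) {x : V} (hx : x ∈ D) :
    HasFDerivAt (f s) ((fderiv ℝ (fun p : ℝ × V => f p.1 p.2) (s, x)).comp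
      (ContinuousLinearMap.inr ℝ ℝ V)) x :=
  (h.hasFDerivAt s hx).comp x (hasFDerivAt_prodMk_right s x)

lemma differentiableOn (h : IsTame f D M) (s : ℝ) : DifferentiableOn ℝ (f s) D :=
  fun _ hx => (h.hasFDerivAt_state s hx).differentiableAt.differentiableWithinAt

lemma continuousOn_fderiv (h : IsTame f D M) :
    ContinuousOn (fderiv ℝ (fun p : ℝ × V => f p.1 p.2)) (univ ×ˢ D) :=
  h.smooth.continuousOn_fderiv_of_isOpen (isOpen_univ.prod h.isOpen) le_rfl

lemma lipschitz (h : IsTame f D M) (s : ℝ) {x y : V} (hx : x ∈ D) (hy : y ∈ D) :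
    ‖f s x - f s y‖ ≤ M * ‖x - y‖ :=
  h.convex.norm_image_sub_le_of_norm_hasFDerivWithin_le
    (fun z hz => (h.hasFDerivAt_state s hz).hasFDerivWithinAt)
    (fun z hz => by rw [← (h.hasFDerivAt_state s hz).fderiv]; exact h.bound_fderiv s z hz) hy hx

lemma continuous_time (h : IsTame f D M) {x : V} (hx : x ∈ D) : Continuous fun s => f s x :=
  continuousOn_univ.1 (h.smooth.continuousOn.comp (f := fun s : ℝ => (s, x)) (by fun_prop)
    fun _ _ => ⟨mem_univ _, hx⟩)

lemma continuous_fderiv_time (h : IsTame f D M) {x : V} (hx : x ∈ D) :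
    Continuous fun s => fderiv ℝ (fun p : ℝ × V => f p.1 p.2) (s, x) :=
  continuousOn_univ.1 (h.continuousOn_fderiv.comp (f := fun s : ℝ => (s, x)) (by fun_prop)
    fun _ _ => ⟨mem_univ _, hx⟩)

/-- The joint derivative is bounded near a point, uniformly for bounded time shifts. -/
lemma exists_bound_fderiv (h : IsTame f D M) (s R : ℝ) {x : V} (hx : x ∈ D) :
    ∃ B, 0 ≤ B ∧ ∀ᶠ p : ℝ × V in nhds (s, x), p.2 ∈ D ∧ ∀ r ∈ Icc (-R) R,
      ‖fderiv ℝ (fun p : ℝ × V => f p.1 p.2) (p.1 + r, p.2)‖ ≤ B := by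
  have hgc : Continuous fun r : ℝ => fderiv ℝ (fun p : ℝ × V => f p.1 p.2) (s + r, x) :=
    (h.continuous_fderiv_time hx).comp (by fun_prop : Continuous fun r => s + r)
  obtain ⟨B, hB⟩ := (isCompact_Icc (a := -R) (b := R)).bddAbove_image
    (Continuous.norm hgc).continuousOn
  refine ⟨max B 0 + 1, by positivity, ?_⟩
  have hD : ∀ᶠ p : ℝ × V in nhds (s, x), p.2 ∈ D :=
    continuous_snd.continuousAt (h.isOpen.mem_nhds hx)
  -- `V` need not be locally compact, so compactness is used only for the shift `r`, as in the tube
  -- lemma.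
  refine hD.and (isCompact_Icc.eventually_forall_of_forall_eventually fun r hr => ?_)
  have hc : ContinuousAt (fun z : (ℝ × V) × ℝ =>
      fderiv ℝ (fun p : ℝ × V => f p.1 p.2) (z.1.1 + z.2, z.1.2)) ((s, x), r) :=
    ContinuousAt.comp (f := fun z : (ℝ × V) × ℝ => (z.1.1 + z.2, z.1.2)) (x := ((s, x), r))
      (h.continuousOn_fderiv.continuousAt
        ((isOpen_univ.prod h.isOpen).mem_nhds ⟨mem_univ _, hx⟩)) (by fun_prop)
  have hn := hc.norm
  refine (hn.eventually_lt continuousAt_const ?_).mono fun z hz => hz.le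
  have := hB (mem_image_of_mem _ hr)
  exact lt_of_le_of_lt (this.trans (le_max_left _ _)) (lt_add_one _)

end IsTame

end Averaging

/-! ### The corrector and its derivatives -/

section Averaging

variable {V : Type*} [NormedAddCommGroup V] [NormedSpace ℝ V]

/-- The average of the vector field `f` over the time shifts `a σ`, `σ` distributed by `ν`. -/
noncomputable def shiftAverage (f : ℝ → V → V) (ν : Measure ℝ) (a s : ℝ) (x : V) : V :=
  ∫ σ, f (s + a * σ) x ∂ν

/-- The distribution of the pairs `(σ, θ)` with `σ` distributed by `ν` and `θ` uniform on
`[0, 1]`. -/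
noncomputable def shiftMeasure (ν : Measure ℝ) : Measure (ℝ × ℝ) :=
  ν.prod (volume.restrict (Icc (0 : ℝ) 1))

/-- The corrector `∬ a σ f(s + θ a σ, x) dθ dν(σ)`. Its time derivative is the difference of the
averaged and of the original vector field. -/
noncomputable def corrector (f : ℝ → V → V) (ν : Measure ℝ) (a s : ℝ) (x : V) : V :=
  ∫ q, (a * q.1) • f (s + q.2 * (a * q.1)) x ∂(shiftMeasure ν)

/-- The derivative of the corrector in the state. -/
noncomputable def correctorFDeriv (f : ℝ → V → V) (ν : Measure ℝ) (a s : ℝ) (x : V) : V →L[ℝ] V :=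
  ∫ q, (a * q.1) • fderiv ℝ (f (s + q.2 * (a * q.1))) x ∂(shiftMeasure ν)

instance {ν : Measure ℝ} [IsProbabilityMeasure ν] : IsProbabilityMeasure (shiftMeasure ν) := by
  have : IsProbabilityMeasure (volume.restrict (Icc (0 : ℝ) 1)) := ⟨by simp⟩
  unfold shiftMeasure
  infer_instance

lemma ae_shiftMeasure {ν : Measure ℝ} [IsProbabilityMeasure ν] (hν : ∀ᵐ σ ∂ν, |σ| ≤ 1 / 2) :
    ∀ᵐ q ∂(shiftMeasure ν), |q.1| ≤ 1 / 2 ∧ q.2 ∈ Icc (0 : ℝ) 1 := by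
  have h1 := Measure.quasiMeasurePreserving_fst
    (μ := ν) (ν := volume.restrict (Icc (0 : ℝ) 1)) |>.ae hν
  have h2 := Measure.quasiMeasurePreserving_snd
    (μ := ν) (ν := volume.restrict (Icc (0 : ℝ) 1)) |>.ae (ae_restrict_mem measurableSet_Icc)
  exact h1.and h2

namespace IsTame

variable {f : ℝ → V → V} {D : Set V} {M : ℝ} {ν : Measure ℝ} [IsProbabilityMeasure ν] {a : ℝ}

lemma integrable_shift (h : IsTame f D M) (a s : ℝ) {x : V} (hx : x ∈ D) :
    Integrable (fun σ => f (s + a * σ) x) ν :=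
  (integrable_const M).mono'
    ((h.continuous_time hx).comp (by fun_prop : Continuous fun σ => s + a * σ)).aestronglyMeasurable
    (ae_of_all _ fun _ => h.bound _ x hx)

lemma norm_shiftAverage_le (h : IsTame f D M) (s : ℝ) {x : V} (hx : x ∈ D) :
    ‖shiftAverage f ν a s x‖ ≤ M := by
  rw [shiftAverage]
  simpa using norm_integral_le_of_norm_le_const (μ := ν) (f := fun σ => f (s + a * σ) x)
    (ae_of_all _ fun _ => h.bound _ x hx)

lemma shiftAverage_lipschitz (h : IsTame f D M) (s : ℝ) {x y : V} (hx : x ∈ D) (hy : y ∈ D) :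
    ‖shiftAverage f ν a s x - shiftAverage f ν a s y‖ ≤ M * ‖x - y‖ := by
  rw [shiftAverage, shiftAverage,
    ← integral_sub (h.integrable_shift a s hx) (h.integrable_shift a s hy)]
  simpa using norm_integral_le_of_norm_le_const (μ := ν)
    (f := fun σ => f (s + a * σ) x - f (s + a * σ) y)
    (ae_of_all _ fun _ => h.lipschitz _ hx hy)

lemma ae_abs_shift_le (ha : 0 ≤ a) (hν : ∀ᵐ σ ∂ν, |σ| ≤ 1 / 2) :
    ∀ᵐ q ∂(shiftMeasure ν), |a * q.1| ≤ a / 2 ∧ q.2 * (a * q.1) ∈ Icc (-(a / 2)) (a / 2) := by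
  filter_upwards [ae_shiftMeasure hν] with q ⟨h1, h2⟩
  have h3 : |a * q.1| ≤ a / 2 := by
    rw [abs_mul, abs_of_nonneg ha]; nlinarith
  refine ⟨h3, abs_le.1 ?_⟩
  rw [abs_mul, abs_of_nonneg h2.1]
  nlinarith [h2.2, h2.1, abs_nonneg (a * q.1)]

lemma integrable_corrector (h : IsTame f D M) (ha : 0 ≤ a) (hν : ∀ᵐ σ ∂ν, |σ| ≤ 1 / 2) (s : ℝ)
    {x : V} (hx : x ∈ D) :
    Integrable (fun q : ℝ × ℝ => (a * q.1) • f (s + q.2 * (a * q.1)) x) (shiftMeasure ν) := by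
  refine (integrable_const (a / 2 * M)).mono' (Continuous.aestronglyMeasurable ?_) ?_
  · have := (h.continuous_time hx).comp
      (by fun_prop : Continuous fun q : ℝ × ℝ => s + q.2 * (a * q.1))
    exact (by fun_prop : Continuous fun q : ℝ × ℝ => a * q.1).smul this
  · filter_upwards [ae_abs_shift_le ha hν] with q hq
    rw [norm_smul]
    exact mul_le_mul hq.1 (h.bound _ x hx) (norm_nonneg _) (by positivity)

lemma norm_corrector_le (h : IsTame f D M) (ha : 0 ≤ a) (hν : ∀ᵐ σ ∂ν, |σ| ≤ 1 / 2) (s : ℝ)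
    {x : V} (hx : x ∈ D) : ‖corrector f ν a s x‖ ≤ a / 2 * M := by
  have := norm_integral_le_of_norm_le_const (μ := shiftMeasure ν)
    (f := fun q : ℝ × ℝ => (a * q.1) • f (s + q.2 * (a * q.1)) x) (C := a / 2 * M) ?_
  · simpa [corrector, correctorFDeriv] using this
  · filter_upwards [ae_abs_shift_le ha hν] with q hq
    rw [norm_smul]
    exact mul_le_mul hq.1 (h.bound _ x hx) (norm_nonneg _) (by positivity)

lemma corrector_lipschitz (h : IsTame f D M) (ha : 0 ≤ a) (hν : ∀ᵐ σ ∂ν, |σ| ≤ 1 / 2) (s : ℝ)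
    {x y : V} (hx : x ∈ D) (hy : y ∈ D) :
    ‖corrector f ν a s x - corrector f ν a s y‖ ≤ a / 2 * (M * ‖x - y‖) := by
  rw [corrector, corrector, ← integral_sub (h.integrable_corrector ha hν s hx)
    (h.integrable_corrector ha hν s hy)]
  have := norm_integral_le_of_norm_le_const (μ := shiftMeasure ν)
    (f := fun q : ℝ × ℝ => (a * q.1) • f (s + q.2 * (a * q.1)) x -
      (a * q.1) • f (s + q.2 * (a * q.1)) y) (C := a / 2 * (M * ‖x - y‖)) ?_
  · simpa [corrector, correctorFDeriv] using this
  · filter_upwards [ae_abs_shift_le ha hν] with q hq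
    rw [← smul_sub, norm_smul]
    exact mul_le_mul hq.1 (h.lipschitz _ hx hy) (norm_nonneg _) (by positivity)

lemma continuous_fderiv_state (h : IsTame f D M) {x : V} (hx : x ∈ D) :
    Continuous fun s => fderiv ℝ (f s) x := by
  simp_rw [fun s => (h.hasFDerivAt_state s hx).fderiv]
  exact (h.continuous_fderiv_time hx).clm_comp continuous_const

lemma integrable_correctorFDeriv (h : IsTame f D M) (ha : 0 ≤ a) (hν : ∀ᵐ σ ∂ν, |σ| ≤ 1 / 2)
    (s : ℝ) {x : V} (hx : x ∈ D) :
    Integrable (fun q : ℝ × ℝ => (a * q.1) • fderiv ℝ (f (s + q.2 * (a * q.1))) x)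
      (shiftMeasure ν) := by
  refine (integrable_const (a / 2 * M)).mono' (Continuous.aestronglyMeasurable ?_) ?_
  · have := (h.continuous_fderiv_state hx).comp
      (by fun_prop : Continuous fun q : ℝ × ℝ => s + q.2 * (a * q.1))
    exact (by fun_prop : Continuous fun q : ℝ × ℝ => a * q.1).smul this
  · filter_upwards [ae_abs_shift_le ha hν] with q hq
    rw [norm_smul]
    exact mul_le_mul hq.1 (h.bound_fderiv _ x hx) (norm_nonneg _) (by positivity)

lemma norm_correctorFDeriv_le (h : IsTame f D M) (ha : 0 ≤ a) (hν : ∀ᵐ σ ∂ν, |σ| ≤ 1 / 2) (s : ℝ)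
    {x : V} (hx : x ∈ D) : ‖correctorFDeriv f ν a s x‖ ≤ a / 2 * M := by
  have := norm_integral_le_of_norm_le_const (μ := shiftMeasure ν)
    (f := fun q : ℝ × ℝ => (a * q.1) • fderiv ℝ (f (s + q.2 * (a * q.1))) x) (C := a / 2 * M) ?_
  · simpa [corrector, correctorFDeriv] using this
  · filter_upwards [ae_abs_shift_le ha hν] with q hq
    rw [norm_smul]
    exact mul_le_mul hq.1 (h.bound_fderiv _ x hx) (norm_nonneg _) (by positivity)

lemma correctorFDeriv_lipschitz (h : IsTame f D M) (ha : 0 ≤ a) (hν : ∀ᵐ σ ∂ν, |σ| ≤ 1 / 2)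
    (s : ℝ) {x y : V} (hx : x ∈ D) (hy : y ∈ D) :
    ‖correctorFDeriv f ν a s x - correctorFDeriv f ν a s y‖ ≤ a / 2 * (M * ‖x - y‖) := by
  rw [correctorFDeriv, correctorFDeriv, ← integral_sub (h.integrable_correctorFDeriv ha hν s hx)
    (h.integrable_correctorFDeriv ha hν s hy)]
  have := norm_integral_le_of_norm_le_const (μ := shiftMeasure ν)
    (f := fun q : ℝ × ℝ => (a * q.1) • fderiv ℝ (f (s + q.2 * (a * q.1))) x -
      (a * q.1) • fderiv ℝ (f (s + q.2 * (a * q.1))) y) (C := a / 2 * (M * ‖x - y‖)) ?_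
  · simpa [corrector, correctorFDeriv] using this
  · filter_upwards [ae_abs_shift_le ha hν] with q hq
    rw [← smul_sub, norm_smul]
    exact mul_le_mul hq.1 (h.lip_fderiv _ x hx y hy) (norm_nonneg _) (by positivity)

/-- Differentiation under the integral sign. The local bound `B` on the joint derivative serves only
as a dominating constant, so it may blow up as `ε → 0` without entering any estimate. -/
lemma hasFDerivAt_corrector_integral (h : IsTame f D M) (ha : 0 ≤ a)
    (hν : ∀ᵐ σ ∂ν, |σ| ≤ 1 / 2) (s : ℝ) {x : V} (hx : x ∈ D) :
    Integrable (fun q : ℝ × ℝ => (a * q.1) •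
        fderiv ℝ (fun p : ℝ × V => f p.1 p.2) (s + q.2 * (a * q.1), x)) (shiftMeasure ν) ∧
    HasFDerivAt (fun p : ℝ × V => corrector f ν a p.1 p.2)
      (∫ q, (a * q.1) • fderiv ℝ (fun p : ℝ × V => f p.1 p.2) (s + q.2 * (a * q.1), x)
        ∂(shiftMeasure ν)) (s, x) := by
  obtain ⟨B, hB0, hB⟩ := h.exists_bound_fderiv s (a / 2) hx
  have hmeas : AEStronglyMeasurable (fun q : ℝ × ℝ => (a * q.1) •
      fderiv ℝ (fun p : ℝ × V => f p.1 p.2) (s + q.2 * (a * q.1), x)) (shiftMeasure ν) := by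
    apply Continuous.aestronglyMeasurable
    have := (h.continuous_fderiv_time hx).comp
      (by fun_prop : Continuous fun q : ℝ × ℝ => s + q.2 * (a * q.1))
    exact (by fun_prop : Continuous fun q : ℝ × ℝ => a * q.1).smul this
  have hbd : ∀ᵐ q ∂(shiftMeasure ν), ∀ p ∈ {p : ℝ × V | p.2 ∈ D ∧ ∀ r ∈ Icc (-(a / 2)) (a / 2),
      ‖fderiv ℝ (fun p : ℝ × V => f p.1 p.2) (p.1 + r, p.2)‖ ≤ B},
      ‖(a * q.1) • fderiv ℝ (fun p : ℝ × V => f p.1 p.2) (p.1 + q.2 * (a * q.1), p.2)‖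
        ≤ a / 2 * B := by
    filter_upwards [ae_abs_shift_le ha hν] with q hq p hp
    rw [norm_smul]
    exact mul_le_mul hq.1 (hp.2 _ hq.2) (norm_nonneg _) (by positivity)
  refine ⟨(integrable_const (a / 2 * B)).mono' hmeas
    (hbd.mono fun q hq => hq (s, x) hB.self_of_nhds), ?_⟩
  refine hasFDerivAt_integral_of_dominated_of_fderiv_le (𝕜 := ℝ) (bound := fun _ => a / 2 * B)
    (F := fun (p : ℝ × V) (q : ℝ × ℝ) => (a * q.1) • f (p.1 + q.2 * (a * q.1)) p.2)
    (F' := fun (p : ℝ × V) (q : ℝ × ℝ) => (a * q.1) •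
      fderiv ℝ (fun p : ℝ × V => f p.1 p.2) (p.1 + q.2 * (a * q.1), p.2))
    (x₀ := (s, x)) hB (hB.mono fun p hp => (h.integrable_corrector ha hν p.1 hp.1).1)
    (h.integrable_corrector ha hν s hx) hmeas hbd (integrable_const _)
    (ae_of_all _ fun q p hp => ?_)
  have h1 : HasFDerivAt (fun p : ℝ × V => (p.1 + q.2 * (a * q.1), p.2))
      (ContinuousLinearMap.id ℝ (ℝ × V)) p := by
    have := (hasFDerivAt_id (𝕜 := ℝ) p).add_const (q.2 * (a * q.1), (0 : V))
    convert! this using 1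
    ext p <;> simp
  have := ((h.hasFDerivAt (p.1 + q.2 * (a * q.1)) hp.1).comp p h1).const_smul (a * q.1)
  rw [ContinuousLinearMap.comp_id] at this
  exact this

/-- For fixed `σ` the integrand is the `θ`-derivative of `f (s + θ * (a * σ)) x`, so the inner
integral telescopes to `f (s + a * σ) x - f s x`. Averaging over the probability measure `ν` gives
the claim. -/
lemma integral_time_derivative [CompleteSpace V] (h : IsTame f D M) (ha : 0 ≤ a)
    (hν : ∀ᵐ σ ∂ν, |σ| ≤ 1 / 2) (s : ℝ) {x : V} (hx : x ∈ D) :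
    (∫ q, (a * q.1) • fderiv ℝ (fun p : ℝ × V => f p.1 p.2) (s + q.2 * (a * q.1), x)
        ∂(shiftMeasure ν)) (1, 0) = shiftAverage f ν a s x - f s x := by
  have hint := (h.hasFDerivAt_corrector_integral ha hν s hx).1
  rw [ContinuousLinearMap.integral_apply hint, shiftMeasure, integral_prod]
  swap
  · exact hint.apply_continuousLinearMap (1, 0)
  have hin : ∀ σ : ℝ, ∫ θ in Icc (0 : ℝ) 1, ((a * σ) •
      fderiv ℝ (fun p : ℝ × V => f p.1 p.2) (s + θ * (a * σ), x)) (1, 0) =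
      f (s + a * σ) x - f s x := by
    intro σ
    rw [integral_Icc_eq_integral_Ioc, ← intervalIntegral.integral_of_le zero_le_one]
    rw [intervalIntegral.integral_eq_sub_of_hasDerivAt (f := fun θ => f (s + θ * (a * σ)) x)]
    · simp
    · intro θ _
      have h1 : HasDerivAt (fun θ : ℝ => (s + θ * (a * σ), x)) (a * σ, (0 : V)) θ := by
        refine HasDerivAt.prodMk ?_ (hasDerivAt_const _ _)
        simpa using ((hasDerivAt_id θ).mul_const (a * σ)).const_add s
      have h2 := (h.hasFDerivAt (s + θ * (a * σ)) hx).comp_hasDerivAt θ h1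
      convert! h2 using 1
      rw [smul_apply, ← map_smul]
      simp
    · apply Continuous.intervalIntegrable
      have := (h.continuous_fderiv_time hx).comp
        (by fun_prop : Continuous fun θ : ℝ => s + θ * (a * σ))
      exact (this.const_smul (a * σ)).clm_apply continuous_const
  simp_rw [hin]
  rw [integral_sub (h.integrable_shift a s hx) (integrable_const _)]
  simp [shiftAverage]

lemma integral_state_derivative (h : IsTame f D M) (ha : 0 ≤ a)
    (hν : ∀ᵐ σ ∂ν, |σ| ≤ 1 / 2) (s : ℝ) {x : V} (hx : x ∈ D) (v : V) :
    (∫ q, (a * q.1) • fderiv ℝ (fun p : ℝ × V => f p.1 p.2) (s + q.2 * (a * q.1), x)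
        ∂(shiftMeasure ν)) (0, v) = correctorFDeriv f ν a s x v := by
  rw [ContinuousLinearMap.integral_apply (h.hasFDerivAt_corrector_integral ha hν s hx).1,
    correctorFDeriv, ContinuousLinearMap.integral_apply (h.integrable_correctorFDeriv ha hν s hx)]
  congr 1
  ext q
  rw [(h.hasFDerivAt_state _ hx).fderiv]
  simp

/-- The derivative of the corrector along a curve. -/
lemma hasDerivWithinAt_corrector [CompleteSpace V] (h : IsTame f D M) (ha : 0 ≤ a)
    (hν : ∀ᵐ σ ∂ν, |σ| ≤ 1 / 2) {w : ℝ → V} {w' : V} {A : Set ℝ} {s : ℝ} (hx : w s ∈ D)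
    (hw : HasDerivWithinAt w w' A s) :
    HasDerivWithinAt (fun r => corrector f ν a r (w r))
      (shiftAverage f ν a s (w s) - f s (w s) + correctorFDeriv f ν a s (w s) w') A s := by
  have h1 : HasDerivWithinAt (fun r => (r, w r)) ((1 : ℝ), w') A s :=
    (hasDerivWithinAt_id s A).prodMk hw
  have h2 := (h.hasFDerivAt_corrector_integral ha hν s hx).2.comp_hasDerivWithinAt s h1
  have e : ((1 : ℝ), w') = (1, 0) + (0, w') := by simp
  rw [e, map_add, h.integral_time_derivative ha hν s hx, h.integral_state_derivative ha hν s hx]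
    at h2
  exact h2

end IsTame

end Averaging

/-! ### Size and Lipschitz constant of the averaging error -/

section Averaging

variable {V : Type*} [NormedAddCommGroup V] [InnerProductSpace ℝ V]

/-- Two solutions of a Lipschitz equation separate at most exponentially. -/
lemma IsSolution.norm_sub_le {f : ℝ → V → V} {D : Set V} {M t b : ℝ} (hM : 0 ≤ M)
    (hf : ∀ s, ∀ x ∈ D, ∀ y ∈ D, ‖f s x - f s y‖ ≤ M * ‖x - y‖) {x y : V} {w v : ℝ → V}
    (hw : IsSolution f D t b x w) (hv : IsSolution f D t b y v) :
    ∀ s ∈ Icc t b, ‖w s - v s‖ ≤ ‖x - y‖ * Real.exp (M * (s - t)) := by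
  intro s hs
  have := norm_le_of_norm_hasDerivWithinAt_le (z := fun s => w s - v s) (δ := ‖x - y‖) (ε := 0)
    hM le_rfl (fun r hr => (hw.2 r hr).2.sub (hv.2 r hr).2)
    (by rw [hw.1, hv.1]) (fun r hr => by
      simpa using hf r _ (hw.2 r hr).1 _ (hv.2 r hr).1) s hs
  simpa using this

/-- The constant in the averaging error bound. -/
noncomputable def avgConst (M T : ℝ) : ℝ :=
  (M / 2 + M ^ 2 * T) * Real.exp (M * T) + M / 2

/-- The constant in the Lipschitz bound for the averaging error. -/
noncomputable def avgLipConst (M T : ℝ) : ℝ :=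
  (M / 2 + Real.exp (M * T) * (3 / 2 * M ^ 2 + M * avgConst M T) * T) * Real.exp (M * T)
    + M / 2 * Real.exp (M * T)

lemma avgConst_nonneg {M T : ℝ} (hM : 0 ≤ M) (hT : 0 ≤ T) : 0 ≤ avgConst M T := by
  unfold avgConst; positivity

lemma avgLipConst_nonneg {M T : ℝ} (hM : 0 ≤ M) (hT : 0 ≤ T) : 0 ≤ avgLipConst M T := by
  have := avgConst_nonneg hM hT
  unfold avgLipConst; positivity

namespace IsTame

variable [CompleteSpace V] {f : ℝ → V → V} {D : Set V} {M : ℝ} {ν : Measure ℝ} [IsProbabilityMeasure ν]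
  {a t b T : ℝ}

/-- The difference of a solution and an averaged solution, corrected to have a small
derivative. -/
lemma hasDerivWithinAt_corrected (h : IsTame f D M) (ha : 0 ≤ a)
    (hν : ∀ᵐ σ ∂ν, |σ| ≤ 1 / 2) {x : V} {w v : ℝ → V} (hw : IsSolution f D t b x w)
    (hv : IsSolution (shiftAverage f ν a) D t b x v) {s : ℝ} (hs : s ∈ Icc t b) :
    HasDerivWithinAt (fun r => w r - v r + corrector f ν a r (v r))
      (f s (w s) - f s (v s) + correctorFDeriv f ν a s (v s) (shiftAverage f ν a s (v s)))
      (Icc t b) s := by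
  have := ((hw.2 s hs).2.sub (hv.2 s hs).2).add
    (h.hasDerivWithinAt_corrector ha hν (hv.2 s hs).1 (hv.2 s hs).2)
  convert! this using 1
  abel

/-- Averaging over time shifts of size at most `a / 2` perturbs solutions by `O(a)`. -/
lemma norm_sub_averaged_le (h : IsTame f D M) (ha : 0 ≤ a)
    (hν : ∀ᵐ σ ∂ν, |σ| ≤ 1 / 2) {x : V} {w v : ℝ → V} (hw : IsSolution f D t b x w)
    (hv : IsSolution (shiftAverage f ν a) D t b x v) (hT : b - t ≤ T) {s : ℝ}
    (hs : s ∈ Icc t b) : ‖w s - v s‖ ≤ a * avgConst M T := by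
  have hM := h.nonneg
  have hcor : ∀ r ∈ Icc t b, ‖corrector f ν a r (v r)‖ ≤ a / 2 * M :=
    fun r hr => h.norm_corrector_le ha hν r (hv.2 r hr).1
  have hdiff : ∀ r ∈ Icc t b,
      ‖w r - v r‖ ≤ ‖w r - v r + corrector f ν a r (v r)‖ + a / 2 * M := by
    intro r hr
    have := norm_sub_le (w r - v r + corrector f ν a r (v r)) (corrector f ν a r (v r))
    rw [add_sub_cancel_right] at this
    linarith [hcor r hr]
  have htb : t ∈ Icc t b := ⟨le_rfl, hs.1.trans hs.2⟩
  -- One half of `a * M ^ 2` comes from returning from `w - v` to the corrected difference, the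
  -- other from the state derivative of the corrector applied to the averaged field.
  have key := norm_le_of_norm_hasDerivWithinAt_le (δ := a / 2 * M) (K := M) (ε := a * M ^ 2) hM
    (by positivity) (fun r hr => h.hasDerivWithinAt_corrected ha hν hw hv hr)
    (by simpa [hw.1, hv.1] using hcor t htb) (fun r hr => by
      have h1 := h.lipschitz r (hw.2 r hr).1 (hv.2 r hr).1
      have h2 : ‖correctorFDeriv f ν a r (v r) (shiftAverage f ν a r (v r))‖ ≤ a / 2 * M * M :=
        ((correctorFDeriv f ν a r (v r)).le_opNorm _).trans
          (mul_le_mul (h.norm_correctorFDeriv_le ha hν r (hv.2 r hr).1)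
            (h.norm_shiftAverage_le r (hv.2 r hr).1) (norm_nonneg _) (by positivity))
      have h3 := mul_le_mul_of_nonneg_left (hdiff r hr) hM
      refine (norm_add_le _ _).trans ?_
      nlinarith) s hs
  have hsT : s - t ≤ T := by linarith [hs.2]
  have hst : 0 ≤ s - t := sub_nonneg.2 hs.1
  have hle : (a / 2 * M + a * M ^ 2 * (s - t)) * Real.exp (M * (s - t)) ≤
      (a / 2 * M + a * M ^ 2 * T) * Real.exp (M * T) := by
    have : 0 ≤ T := hst.trans hsT
    gcongr
  calc ‖w s - v s‖ ≤ (a / 2 * M + a * M ^ 2 * T) * Real.exp (M * T) + a / 2 * M :=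
        (hdiff s hs).trans (by linarith)
    _ = a * avgConst M T := by rw [avgConst]; ring

/-- The averaging error is Lipschitz continuous in the initial value with constant `O(a)`. -/
lemma norm_averagingError_sub_le (h : IsTame f D M) (ha : 0 ≤ a)
    (hν : ∀ᵐ σ ∂ν, |σ| ≤ 1 / 2) {x y : V} {w v w₂ v₂ : ℝ → V} (hw : IsSolution f D t b x w)
    (hv : IsSolution (shiftAverage f ν a) D t b x v) (hw₂ : IsSolution f D t b y w₂)
    (hv₂ : IsSolution (shiftAverage f ν a) D t b y v₂) (hT : b - t ≤ T) {s : ℝ}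
    (hs : s ∈ Icc t b) :
    ‖(w s - v s) - (w₂ s - v₂ s)‖ ≤ a * avgLipConst M T * ‖x - y‖ := by
  have hM := h.nonneg
  have htb : t ∈ Icc t b := ⟨le_rfl, hs.1.trans hs.2⟩
  have hsT : s - t ≤ T := by linarith [hs.2]
  have hst : 0 ≤ s - t := sub_nonneg.2 hs.1
  have hT0 : 0 ≤ T := hst.trans hsT
  have hB := avgConst_nonneg hM hT0
  set R := ‖x - y‖ * Real.exp (M * T) with hR
  have hR0 : 0 ≤ R := by positivity
  have hexp : ∀ r ∈ Icc t b, ‖x - y‖ * Real.exp (M * (r - t)) ≤ R := by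
    intro r hr
    have : r - t ≤ T := by linarith [hr.2]
    rw [hR]; gcongr
  have hww : ∀ r ∈ Icc t b, ‖w r - w₂ r‖ ≤ R := fun r hr =>
    (hw.norm_sub_le hM (fun s x hx y hy => h.lipschitz s hx hy) hw₂ r hr).trans (hexp r hr)
  have hvv : ∀ r ∈ Icc t b, ‖v r - v₂ r‖ ≤ R := fun r hr =>
    (hv.norm_sub_le hM (fun s x hx y hy => h.shiftAverage_lipschitz s hx hy) hv₂ r hr).trans
      (hexp r hr)
  set z := fun r => (w r - v r + corrector f ν a r (v r)) -
    (w₂ r - v₂ r + corrector f ν a r (v₂ r)) with hz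
  have hcor : ∀ r ∈ Icc t b,
      ‖corrector f ν a r (v r) - corrector f ν a r (v₂ r)‖ ≤ a / 2 * (M * R) := fun r hr =>
    (h.corrector_lipschitz ha hν r (hv.2 r hr).1 (hv₂.2 r hr).1).trans
      (by have := hvv r hr; gcongr)
  have hdiff : ∀ r ∈ Icc t b, ‖(w r - v r) - (w₂ r - v₂ r)‖ ≤ ‖z r‖ + a / 2 * (M * R) := by
    intro r hr
    have := norm_sub_le (z r) (corrector f ν a r (v r) - corrector f ν a r (v₂ r))
    have e : z r - (corrector f ν a r (v r) - corrector f ν a r (v₂ r)) =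
        (w r - v r) - (w₂ r - v₂ r) := by simp only [hz]; abel
    rw [e] at this
    linarith [hcor r hr]
  -- Of `3/2 * M ^ 2`, one half comes from removing the corrector from `z` and one from the product
  -- rule for the corrector terms. The summand `M * avgConst M T` is the second-order part of the
  -- second difference of `f`, where `w₂ - v₂` is already `O(a)`.
  have key := norm_le_of_norm_hasDerivWithinAt_le (z := z) (δ := a / 2 * (M * ‖x - y‖)) (K := M)
    (ε := a * R * (3 / 2 * M ^ 2 + M * avgConst M T)) hM (by positivity)
    (fun r hr => (h.hasDerivWithinAt_corrected ha hν hw hv hr).sub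
      (h.hasDerivWithinAt_corrected ha hν hw₂ hv₂ hr))
    (by
      have h1 := h.corrector_lipschitz ha hν t (hv.2 t htb).1 (hv₂.2 t htb).1
      have e : z t = corrector f ν a t (v t) - corrector f ν a t (v₂ t) := by
        simp only [hz]; rw [hw.1, hv.1, hw₂.1, hv₂.1]; abel
      rw [e]
      rwa [hv.1, hv₂.1] at h1 ⊢)
    (fun r hr => by
      have m1 := (hw.2 r hr).1
      have m2 := (hv.2 r hr).1
      have m3 := (hw₂.2 r hr).1
      have m4 := (hv₂.2 r hr).1
      have h1 := norm_second_difference_le hM h.isOpen h.convex (h.differentiableOn r)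
        (h.bound_fderiv r) (h.lip_fderiv r) m1 m2 m3 m4 (hww r hr) (hvv r hr)
      have h2 := h.norm_sub_averaged_le ha hν hw₂ hv₂ hT hr
      have h3 : ‖correctorFDeriv f ν a r (v r) (shiftAverage f ν a r (v r)) -
          correctorFDeriv f ν a r (v₂ r) (shiftAverage f ν a r (v₂ r))‖ ≤ a * M ^ 2 * R := by
        set A := correctorFDeriv f ν a r (v r)
        set B := correctorFDeriv f ν a r (v₂ r)
        set p := shiftAverage f ν a r (v r)
        set q := shiftAverage f ν a r (v₂ r)
        have e : A p - B q = (A - B) p + B (p - q) := by simp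
        rw [e]
        have h4 : ‖(A - B) p‖ ≤ a / 2 * (M * R) * M :=
          ((A - B).le_opNorm _).trans (mul_le_mul
            ((h.correctorFDeriv_lipschitz ha hν r m2 m4).trans
              (by have := hvv r hr; gcongr))
            (h.norm_shiftAverage_le r m2) (norm_nonneg _) (by positivity))
        have h5 : ‖B (p - q)‖ ≤ a / 2 * M * (M * R) :=
          (B.le_opNorm _).trans (mul_le_mul (h.norm_correctorFDeriv_le ha hν r m4)
            ((h.shiftAverage_lipschitz r m2 m4).trans (by have := hvv r hr; gcongr))
            (norm_nonneg _) (by positivity))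
        refine (norm_add_le _ _).trans ?_
        linarith
      have e : (f r (w r) - f r (v r) + correctorFDeriv f ν a r (v r) (shiftAverage f ν a r (v r)))
          - (f r (w₂ r) - f r (v₂ r) +
            correctorFDeriv f ν a r (v₂ r) (shiftAverage f ν a r (v₂ r))) =
          ((f r (w r) - f r (v r)) - (f r (w₂ r) - f r (v₂ r))) +
          (correctorFDeriv f ν a r (v r) (shiftAverage f ν a r (v r)) -
          correctorFDeriv f ν a r (v₂ r) (shiftAverage f ν a r (v₂ r))) := by abel
      rw [e]
      refine (norm_add_le _ _).trans ?_
      have h6 := mul_le_mul_of_nonneg_left (hdiff r hr) hM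
      have h7 := mul_le_mul_of_nonneg_left h2 (mul_nonneg hM hR0)
      linarith) s hs
  have hle : (a / 2 * (M * ‖x - y‖) + a * R * (3 / 2 * M ^ 2 + M * avgConst M T) * (s - t)) *
      Real.exp (M * (s - t)) ≤
      (a / 2 * (M * ‖x - y‖) + a * R * (3 / 2 * M ^ 2 + M * avgConst M T) * T) *
      Real.exp (M * T) := by
    gcongr
  calc ‖(w s - v s) - (w₂ s - v₂ s)‖
      ≤ (a / 2 * (M * ‖x - y‖) + a * R * (3 / 2 * M ^ 2 + M * avgConst M T) * T) *
        Real.exp (M * T) + a / 2 * (M * R) := (hdiff s hs).trans (by linarith)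
    _ = a * avgLipConst M T * ‖x - y‖ := by rw [avgLipConst, hR]; ring

end IsTame

end Averaging

/-! ### The modulation equation is tame, uniformly in `ε` -/

section Modulation

variable {V : Type*} [NormedAddCommGroup V] [InnerProductSpace ℝ V] [CompleteSpace V]

lemma exp_smul_mem_unitary_of_skew {A : V →L[ℝ] V} (hA : ContinuousLinearMap.adjoint A = -A)
    (τ : ℝ) : NormedSpace.exp (τ • A) ∈ unitary (V →L[ℝ] V) := by
  have h1 : τ • A ∈ skewAdjoint (V →L[ℝ] V) := by
    rw [skewAdjoint.mem_iff, ContinuousLinearMap.star_eq_adjoint, map_smulₛₗ, hA]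
    simp
  let : NormedAlgebra ℚ (V →L[ℝ] V) := NormedAlgebra.restrictScalars ℚ ℝ (V →L[ℝ] V)
  exact NormedSpace.exp_mem_unitary_of_mem_skewAdjoint h1

lemma norm_exp_apply_of_skew {A : V →L[ℝ] V} (hA : ContinuousLinearMap.adjoint A = -A) (τ : ℝ)
    (v : V) : ‖NormedSpace.exp (τ • A) v‖ = ‖v‖ :=
  ContinuousLinearMap.norm_map_of_mem_unitary (exp_smul_mem_unitary_of_skew hA τ) v

lemma opNorm_exp_le_one_of_skew {A : V →L[ℝ] V} (hA : ContinuousLinearMap.adjoint A = -A)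
    (τ : ℝ) : ‖NormedSpace.exp (τ • A)‖ ≤ 1 :=
  ContinuousLinearMap.opNorm_le_bound _ zero_le_one fun v => by
    rw [norm_exp_apply_of_skew hA, one_mul]

lemma contDiff_exp_smul (A : V →L[ℝ] V) : ContDiff ℝ 1 fun τ : ℝ => NormedSpace.exp (τ • A) := by
  rw [contDiff_iff_contDiffAt]
  intro τ
  exact ((NormedSpace.exp_analytic (𝕂 := ℝ) (τ • A)).contDiffAt).comp τ
    (contDiff_id.smul contDiff_const).contDiffAt

/-- The right-hand side of the modulation equation is tame if the nonlinearity is `C²` with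
bounds on an open convex set that is invariant under the linear flow. -/
lemma isTame_modulationRHS {A : V →L[ℝ] V} {Nl : V → V} {D : Set V} {M : ℝ} (ε : ℝ) (hM : 0 ≤ M)
    (hA : ContinuousLinearMap.adjoint A = -A) (hD : IsOpen D) (hDc : Convex ℝ D)
    (hinv : ∀ τ : ℝ, ∀ v ∈ D, NormedSpace.exp (τ • A) v ∈ D) (hN : ContDiffOn ℝ 2 Nl D)
    (h0 : ∀ v ∈ D, ‖Nl v‖ ≤ M) (h1 : ∀ v ∈ D, ‖fderiv ℝ Nl v‖ ≤ M)
    (h2 : ∀ v ∈ D, ‖fderiv ℝ (fderiv ℝ Nl) v‖ ≤ M) : IsTame (modulationRHS A Nl ε) D M := by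
  have hinv' : ∀ τ : ℝ, ∀ v ∈ D, NormedSpace.exp (-(τ • A)) v ∈ D := by
    intro τ v hv
    rw [← neg_smul]
    exact hinv _ v hv
  have hnorm' : ∀ τ : ℝ, ‖NormedSpace.exp (-(τ • A))‖ ≤ 1 := by
    intro τ
    rw [← neg_smul]
    exact opNorm_exp_le_one_of_skew hA _
  have hder : ∀ s, ∀ x ∈ D, fderiv ℝ (modulationRHS A Nl ε s) x =
      (NormedSpace.exp ((s / ε) • A)).comp
        ((fderiv ℝ Nl (NormedSpace.exp (-((s / ε) • A)) x)).comp
          (NormedSpace.exp (-((s / ε) • A)))) := by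
    intro s x hx
    have hd : HasFDerivAt Nl (fderiv ℝ Nl (NormedSpace.exp (-((s / ε) • A)) x))
        (NormedSpace.exp (-((s / ε) • A)) x) :=
      ((hN.differentiableOn two_ne_zero).differentiableAt
        (hD.mem_nhds (hinv' _ x hx))).hasFDerivAt
    exact ((NormedSpace.exp ((s / ε) • A)).hasFDerivAt.comp x
      (hd.comp x (NormedSpace.exp (-((s / ε) • A))).hasFDerivAt)).fderiv
  have hlip : ∀ x ∈ D, ∀ y ∈ D, ‖fderiv ℝ Nl x - fderiv ℝ Nl y‖ ≤ M * ‖x - y‖ := by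
    intro x hx y hy
    have hd : DifferentiableOn ℝ (fderiv ℝ Nl) D :=
      (hN.fderiv_of_isOpen hD (m := 1) (by norm_num)).differentiableOn one_ne_zero
    exact hDc.norm_image_sub_le_of_norm_fderiv_le
      (fun z hz => hd.differentiableAt (hD.mem_nhds hz)) h2 hy hx
  -- Conjugation by the isometries `exp(τ ℒ)` preserves the bounds on the nonlinearity and its state
  -- derivatives. In the time variable only continuous differentiability is claimed.
  refine ⟨hM, hD, hDc, ?_, ?_, ?_, ?_⟩
  · have e1 : ContDiff ℝ 1 fun p : ℝ × V => NormedSpace.exp ((p.1 / ε) • A) :=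
      (contDiff_exp_smul A).comp (contDiff_fst.div_const ε)
    have e2 : ContDiff ℝ 1 fun p : ℝ × V => NormedSpace.exp (-((p.1 / ε) • A)) := by
      simp_rw [← neg_smul]
      exact (contDiff_exp_smul A).comp (contDiff_fst.div_const ε).neg
    exact e1.contDiffOn.clm_apply ((hN.of_le (by norm_num)).comp
      (e2.clm_apply contDiff_snd).contDiffOn fun p hp => hinv' _ _ hp.2)
  · intro s x hx
    rw [modulationRHS, modulated, norm_exp_apply_of_skew hA]
    exact h0 _ (hinv' _ x hx)
  · intro s x hx
    rw [hder s x hx]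
    refine (ContinuousLinearMap.opNorm_comp_le _ _).trans ?_
    have h3 := (ContinuousLinearMap.opNorm_comp_le
      (fderiv ℝ Nl (NormedSpace.exp (-((s / ε) • A)) x)) (NormedSpace.exp (-((s / ε) • A)))).trans
      (mul_le_mul (h1 _ (hinv' _ x hx)) (hnorm' (s / ε)) (norm_nonneg _) hM)
    exact (mul_le_mul (opNorm_exp_le_one_of_skew hA _) h3 (norm_nonneg _) zero_le_one).trans
      (by simp)
  · intro s x hx y hy
    rw [hder s x hx, hder s y hy, ← ContinuousLinearMap.comp_sub, ← ContinuousLinearMap.sub_comp]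
    refine (ContinuousLinearMap.opNorm_comp_le _ _).trans ?_
    have h4 : ‖fderiv ℝ Nl (NormedSpace.exp (-((s / ε) • A)) x) -
        fderiv ℝ Nl (NormedSpace.exp (-((s / ε) • A)) y)‖ ≤ M * ‖x - y‖ := by
      refine (hlip _ (hinv' _ x hx) _ (hinv' _ y hy)).trans ?_
      rw [← map_sub, ← neg_smul, norm_exp_apply_of_skew hA]
    have h3 := (ContinuousLinearMap.opNorm_comp_le
      (fderiv ℝ Nl (NormedSpace.exp (-((s / ε) • A)) x) -
        fderiv ℝ Nl (NormedSpace.exp (-((s / ε) • A)) y)) (NormedSpace.exp (-((s / ε) • A)))).trans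
      (mul_le_mul h4 (hnorm' (s / ε)) (norm_nonneg _) (by positivity))
    exact (mul_le_mul (opNorm_exp_le_one_of_skew hA _) h3 (norm_nonneg _) zero_le_one).trans
      (by simp)

end Modulation

/-! ### The kernel as a probability measure -/

section Kernel

variable {V : Type*} [NormedAddCommGroup V] [InnerProductSpace ℝ V]

/-- The probability measure with density `ρ` on `[-1/2, 1/2]`. -/
noncomputable def kernelMeasure (ρ : ℝ → ℝ) : Measure ℝ :=
  (volume.restrict (Ioc (-(1 / 2) : ℝ) (1 / 2))).withDensity fun s => ENNReal.ofReal (ρ s)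

variable {ρ : ℝ → ℝ}

lemma IsKernel.integrable_restrict (hρ : IsKernel ρ) :
    Integrable ρ (volume.restrict (Ioc (-(1 / 2) : ℝ) (1 / 2))) :=
  (intervalIntegrable_iff_integrableOn_Ioc_of_le (by norm_num)).1 hρ.integrable

lemma IsKernel.ae_nonneg (hρ : IsKernel ρ) :
    ∀ᵐ s ∂(volume.restrict (Ioc (-(1 / 2) : ℝ) (1 / 2))), 0 ≤ ρ s :=
  (ae_restrict_mem measurableSet_Ioc).mono fun _ hs => hρ.nonneg _ (Ioc_subset_Icc_self hs)

lemma IsKernel.isProbabilityMeasure (hρ : IsKernel ρ) :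
    IsProbabilityMeasure (kernelMeasure ρ) := by
  refine ⟨?_⟩
  rw [kernelMeasure, withDensity_apply _ MeasurableSet.univ, Measure.restrict_univ,
    ← ofReal_integral_eq_lintegral_ofReal hρ.integrable_restrict hρ.ae_nonneg,
    ← intervalIntegral.integral_of_le (by norm_num), hρ.integral_eq_one, ENNReal.ofReal_one]

lemma ae_kernelMeasure_abs_le (ρ : ℝ → ℝ) : ∀ᵐ σ ∂(kernelMeasure ρ), |σ| ≤ 1 / 2 :=
  (withDensity_absolutelyContinuous _ _).ae_le
    ((ae_restrict_mem measurableSet_Ioc).mono fun _ hs => abs_le.2 ⟨hs.1.le, hs.2⟩)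

/-- The averaged right-hand side is the average over time shifts of size at most `ε η / 2`. -/
lemma averagedRHS_eq_shiftAverage (A : V →L[ℝ] V) (Nl : V → V) {ε η : ℝ} (hε : 0 < ε) (hη : 0 < η)
    (hρ : IsKernel ρ) : averagedRHS A Nl ε ρ η =
      shiftAverage (modulationRHS A Nl ε) (kernelMeasure ρ) (η * ε) := by
  ext t x
  have h1 : shiftAverage (modulationRHS A Nl ε) (kernelMeasure ρ) (η * ε) t x =
      ∫ σ in (-(1 / 2) : ℝ)..(1 / 2), ρ σ • modulated A Nl (t / ε + η * σ) x := by
    rw [shiftAverage, kernelMeasure, integral_withDensity_eq_integral_toReal_smul₀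
      hρ.integrable_restrict.aemeasurable.ennreal_ofReal (ae_of_all _ fun _ => ENNReal.ofReal_lt_top),
      intervalIntegral.integral_of_le (by norm_num)]
    refine integral_congr_ae (hρ.ae_nonneg.mono fun σ hσ => ?_)
    simp only [modulationRHS]
    rw [ENNReal.toReal_ofReal hσ]
    congr 2
    field_simp
  rw [h1, averagedRHS]
  -- Substitution `s = ησ`. Since `t/ε + ησ = (t + ηεσ)/ε`, the shift in slow time is `ηεσ`.
  have h2 := intervalIntegral.integral_comp_div (a := -(η / 2)) (b := η / 2)
    (fun σ => ρ σ • modulated A Nl (t / ε + η * σ) x) hη.ne'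
  have e1 : -(η / 2) / η = -(1 / 2) := by field_simp
  have e2 : η / 2 / η = 1 / 2 := by field_simp
  rw [e1, e2] at h2
  have h3 : ∀ s : ℝ, η * (s / η) = s := fun s => by field_simp
  simp_rw [h3] at h2
  rw [h2, smul_smul, one_div_mul_cancel hη.ne', one_smul]

end Kernel

/-! ### Scalar error recursions -/

section Recursion

/-- The solution of the error recursion of the Parareal iteration. -/
lemma le_of_parareal_recursion {e : ℕ → ℕ → ℝ} {α β γ δ : ℝ} {N k : ℕ} (hα : 0 ≤ α) (hβ : 1 ≤ β)
    (hγ : 0 ≤ γ) (hδ : 0 ≤ δ) (h0 : ∀ j ≤ k, e j 0 ≤ 0)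
    (hbase : ∀ n < N, e 0 (n + 1) ≤ β * e 0 n + γ)
    (hstep : ∀ n < N, ∀ j < k, e (j + 1) (n + 1) ≤ α * e j n + β * e (j + 1) n + δ) :
    ∀ n ≤ N, ∀ j ≤ k, e j n ≤ (n.choose (j + 1) : ℝ) * γ * α ^ j * β ^ (n - j - 1) +
      δ * (β ^ (n - 1) * ∑ i ∈ Finset.range n, (1 + α) ^ i) := by
  have hβ0 : 0 ≤ β := zero_le_one.trans hβ
  intro n
  induction n with
  | zero => intro _ j hj; simpa using h0 j hj
  | succ n ih =>
    intro hn j hj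
    have hnN : n < N := hn
    set S := ∑ i ∈ Finset.range n, (1 + α) ^ i with hS
    have hS0 : 0 ≤ S := Finset.sum_nonneg fun i _ => by positivity
    have hS1 : ∑ i ∈ Finset.range (n + 1), (1 + α) ^ i = (1 + α) * S + 1 := geom_sum_succ
    have hβS : β * (β ^ (n - 1) * S) = β ^ n * S := by
      rcases n with _ | n
      · simp [hS]
      · simp only [Nat.add_sub_cancel]; ring
    have hβS' : β ^ (n - 1) * S ≤ β ^ n * S :=
      mul_le_mul_of_nonneg_right (pow_le_pow_right₀ hβ (Nat.sub_le _ _)) hS0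
    have hβn : 1 ≤ β ^ n := one_le_pow₀ hβ
    rw [hS1, Nat.add_sub_cancel]
    rcases j with _ | j
    · have h1 := ih hnN.le 0 hj
      have h2 := mul_le_mul_of_nonneg_left h1 hβ0
      have h3 : β * ((n : ℝ) * β ^ (n - 1)) = n * β ^ n := by
        rcases n with _ | n
        · simp
        · simp only [Nat.add_sub_cancel]; ring
      simp only [Nat.zero_add, Nat.choose_one_right, pow_zero, mul_one, Nat.sub_zero,
        Nat.add_sub_cancel] at h2 ⊢
      -- The sum of powers of `β` that solves the base recursion is replaced by its number of terms
      -- times the largest one.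
      have h4 : γ ≤ γ * β ^ n := le_mul_of_one_le_right hγ hβn
      have h5 : δ * (β ^ n * S) ≤ δ * (β ^ n * ((1 + α) * S + 1)) := by
        gcongr
        nlinarith
      calc e 0 (n + 1) ≤ β * e 0 n + γ := hbase n hnN
        _ ≤ β * ((n : ℝ) * γ * β ^ (n - 1) + δ * (β ^ (n - 1) * S)) + γ * β ^ n := by linarith
        _ = γ * (β * ((n : ℝ) * β ^ (n - 1))) + δ * (β * (β ^ (n - 1) * S)) + γ * β ^ n := by ring
        _ = ((n + 1 : ℕ) : ℝ) * γ * β ^ n + δ * (β ^ n * S) := by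
          rw [h3, hβS]; push_cast; ring
        _ ≤ _ := by linarith
    · have h1 := mul_le_mul_of_nonneg_left (ih hnN.le j (Nat.le_of_succ_le hj)) hα
      have h2 := mul_le_mul_of_nonneg_left (ih hnN.le (j + 1) hj) hβ0
      have e1 : n + 1 - (j + 1) - 1 = n - j - 1 := by omega
      -- Where natural subtraction truncates the exponent, the binomial coefficient vanishes.
      have e2 : β * ((n.choose (j + 1 + 1) : ℝ) * β ^ (n - (j + 1) - 1)) =
          (n.choose (j + 1 + 1) : ℝ) * β ^ (n - j - 1) := by
        rcases Nat.lt_or_ge n (j + 1 + 1) with h | h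
        · simp [Nat.choose_eq_zero_of_lt h]
        · have : n - j - 1 = (n - (j + 1) - 1) + 1 := by omega
          rw [this]; ring
      -- Pascal's rule: the old iterate contributes one binomial coefficient, the current one the
      -- other.
      rw [e1, Nat.choose_succ_succ n (j + 1), Nat.cast_add]
      -- The bound for the `δ` part does not depend on `j`, so the `α` and `β` terms combine into
      -- one step of the geometric sum.
      have h3 : δ * (α * (β ^ (n - 1) * S) + β * (β ^ (n - 1) * S) + 1) ≤
          δ * (β ^ n * ((1 + α) * S + 1)) := by
        gcongr
        rw [hβS]
        nlinarith
      calc e (j + 1) (n + 1) ≤ α * e j n + β * e (j + 1) n + δ :=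
            hstep n hnN j (Nat.lt_of_succ_le hj)
        _ ≤ α * ((n.choose (j + 1) : ℝ) * γ * α ^ j * β ^ (n - j - 1) + δ * (β ^ (n - 1) * S)) +
            β * ((n.choose (j + 1 + 1) : ℝ) * γ * α ^ (j + 1) * β ^ (n - (j + 1) - 1) +
              δ * (β ^ (n - 1) * S)) + δ := by linarith
        _ = (n.choose (j + 1) : ℝ) * γ * α ^ (j + 1) * β ^ (n - j - 1) +
            γ * α ^ (j + 1) * (β * ((n.choose (j + 1 + 1) : ℝ) * β ^ (n - (j + 1) - 1))) +
            δ * (α * (β ^ (n - 1) * S) + β * (β ^ (n - 1) * S) + 1) := by ring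
        _ = ((n.choose (j + 1) : ℝ) + n.choose (j + 1 + 1)) * γ * α ^ (j + 1) * β ^ (n - j - 1) +
            δ * (α * (β ^ (n - 1) * S) + β * (β ^ (n - 1) * S) + 1) := by rw [e2]; ring
        _ ≤ _ := by simpa using h3

/-- An intermediate value for the geometric sum. -/
lemma exists_geom_sum_eq {α : ℝ} (hα : 0 ≤ α) (N : ℕ) :
    ∃ α₀ ∈ Icc 0 α, N * (1 + α₀) ^ (N - 1) = ∑ i ∈ Finset.range N, (1 + α) ^ i := by
  have hc : ContinuousOn (fun y : ℝ => (N : ℝ) * (1 + y) ^ (N - 1)) (Icc 0 α) := by fun_prop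
  -- Each of the `N` terms of the sum lies between `1` and `(1 + α) ^ (N - 1)`, the values
  -- corresponding to `α₀ = 0` and `α₀ = α`.
  refine intermediate_value_Icc hα hc ⟨?_, ?_⟩
  · have : ∀ i ∈ Finset.range N, (1 : ℝ) ≤ (1 + α) ^ i := fun i _ => one_le_pow₀ (by linarith)
    simpa using Finset.card_nsmul_le_sum _ _ _ this
  · have : ∀ i ∈ Finset.range N, (1 + α) ^ i ≤ (1 + α) ^ (N - 1) := fun i hi =>
      pow_le_pow_right₀ (by linarith) (Nat.le_sub_one_of_lt (Finset.mem_range.1 hi))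
    simpa using Finset.sum_le_card_nsmul _ _ _ this

/-- Accumulation of local errors. -/
lemma le_of_growth_recursion {e : ℕ → ℝ} {q δ : ℝ} {N : ℕ} (hq : 1 ≤ q) (hδ : 0 ≤ δ)
    (h0 : e 0 ≤ 0) (hstep : ∀ n < N, e (n + 1) ≤ q * e n + δ) :
    ∀ n ≤ N, e n ≤ n * δ * q ^ n := by
  intro n
  induction n with
  | zero => intro _; simpa using h0
  | succ n ih =>
    intro hn
    have h1 := mul_le_mul_of_nonneg_left (ih (Nat.le_of_succ_le hn)) (zero_le_one.trans hq)
    have h2 : δ ≤ δ * q ^ (n + 1) := le_mul_of_one_le_right hδ (one_le_pow₀ hq)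
    have h3 : q * (n * δ * q ^ n) = n * δ * q ^ (n + 1) := by ring
    have := hstep n hn
    push_cast
    linarith

end Recursion

/-! ### Exact propagators -/

section Flow

variable {V : Type*} [NormedAddCommGroup V] [InnerProductSpace ℝ V]

lemma IsSolution.restrict {f : ℝ → V → V} {D : Set V} {t t' b : ℝ} {x : V} {w : ℝ → V}
    (hw : IsSolution f D t b x w) (ht : t ≤ t') : IsSolution f D t' b (w t') w :=
  ⟨rfl, fun s hs => ⟨(hw.2 s ⟨ht.trans hs.1, hs.2⟩).1,
    (hw.2 s ⟨ht.trans hs.1, hs.2⟩).2.mono (Icc_subset_Icc_left ht)⟩⟩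

/-- The chosen solution does not depend on `h`, so a single curve gives all values of the propagator
from `(t, x)`. -/
lemma exists_solution_exactProp {f : ℝ → V → V} {D : Set V} {b t : ℝ} {x : V}
    (H : ∃ w, IsSolution f D t b x w) :
    ∃ w, IsSolution f D t b x w ∧ ∀ h, exactProp f D b t h x = w (t + h) :=
  ⟨H.choose, H.choose_spec, fun h => by rw [exactProp, dif_pos H]⟩

lemma exactProp_zero (f : ℝ → V → V) (D : Set V) (b t : ℝ) (x : V) :
    exactProp f D b t 0 x = x := by
  rw [exactProp]
  split_ifs with H
  · rw [add_zero]; exact H.choose_spec.1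
  · rfl

end Flow

lemma iterate_zero_right {V : Type*} [NormedAddCommGroup V] (G F : ℝ → V → V) (h t : ℝ) (x : V)
    (j : ℕ) : iterate G F h t x j 0 = x := by
  cases j <;> rfl

/-! ### One-step errors and the serial fine propagator -/

namespace Data

section Grid

variable {V : Type*} [NormedAddCommGroup V] [InnerProductSpace ℝ V]

lemma step_succ (d : Data V) (l : ℕ) : d.step (l + 1) = d.N * d.step l := by
  rw [step, step, pow_succ]; ring

lemma U_zero (d : Data V) (l : ℕ) (t : ℝ) (x : V) (j : ℕ) : d.U l t x j 0 = x :=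
  iterate_zero_right _ _ _ _ _ _

lemma P_succ (d : Data V) (l : ℕ) (t : ℝ) (x : V) :
    d.P (l + 1) t x = d.U (l + 1) t x (d.k (l + 1)) d.N := rfl

lemma U_succ_zero_left (d : Data V) (l : ℕ) (t : ℝ) (x : V) (n : ℕ) :
    d.U l t x 0 (n + 1) = d.G l (t + n * d.step l) (d.U l t x 0 n) := by
  rw [U, iterate]; rfl

lemma U_succ_succ (d : Data V) (l : ℕ) (t : ℝ) (x : V) (j n : ℕ) :
    d.U (l + 1) t x (j + 1) (n + 1) =
      d.G (l + 1) (t + n * d.step (l + 1)) (d.U (l + 1) t x (j + 1) n)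
        + d.P l (t + n * d.step (l + 1)) (d.U (l + 1) t x j n)
        - d.G (l + 1) (t + n * d.step (l + 1)) (d.U (l + 1) t x j n) := by
  rw [U, iterate]; rfl

end Grid

namespace Assumptions

variable {V : Type*} [NormedAddCommGroup V] [InnerProductSpace ℝ V] [CompleteSpace V]
  {d : Data V} {M C₁ : ℝ}

lemma isTame (h : d.Assumptions M C₁) (hM : 0 ≤ M) :
    IsTame (modulationRHS d.Lop d.Nl d.ε) d.D M :=
  isTame_modulationRHS d.ε hM h.skew h.D_open h.D_convex h.D_invariant h.Nl_smooth h.Nl_bound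
    h.Nl_bound' h.Nl_bound''

lemma step_pos (h : d.Assumptions M C₁) (l : ℕ) : 0 < d.step l := by
  have : (0 : ℝ) < d.N := by exact_mod_cast h.N_pos
  have := h.dt_pos
  rw [step]; positivity

lemma exists_solution (h : d.Assumptions M C₁) {t : ℝ} (ht : 0 ≤ t) (htT : t ≤ d.T) {x : V}
    (hx : x ∈ d.S) : ∃ w, IsSolution (modulationRHS d.Lop d.Nl d.ε) d.D t d.T x w ∧
      ∀ r, d.E t r x = w (t + r) :=
  exists_solution_exactProp (h.solvable t ht htT x hx)

lemma exists_averaged_solution (h : d.Assumptions M C₁) {l : ℕ} (hl : 1 ≤ l) (hlL : l < d.L)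
    {t : ℝ} (ht : 0 ≤ t) (htT : t ≤ d.T) {x : V} (hx : x ∈ d.S) :
    ∃ w, IsSolution (shiftAverage (modulationRHS d.Lop d.Nl d.ε) (kernelMeasure d.ρ)
      (d.η l * d.ε)) d.D t d.T x w ∧ ∀ r, d.Ebar l t r x = w (t + r) := by
  have := exists_solution_exactProp (h.solvable_avg l hl hlL t ht htT x hx)
  rw [← averagedRHS_eq_shiftAverage d.Lop d.Nl h.ε_pos (h.η_pos l hl hlL) h.kernel]
  exact this

lemma norm_M1_le (h : d.Assumptions M C₁) (hM : 0 ≤ M) {l : ℕ} (hl : 1 ≤ l) (hlL : l < d.L)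
    {t : ℝ} (ht : 0 ≤ t) (htT : t + d.step l ≤ d.T) {x : V} (hx : x ∈ d.S) :
    ‖d.M1 l t x‖ ≤ d.η l * d.ε * avgConst M d.T := by
  have hs := h.step_pos l
  have := h.kernel.isProbabilityMeasure
  have ha : 0 ≤ d.η l * d.ε := (mul_pos (h.η_pos l hl hlL) h.ε_pos).le
  obtain ⟨w, hw, hwE⟩ := h.exists_solution ht (by linarith) hx
  obtain ⟨v, hv, hvE⟩ := h.exists_averaged_solution hl hlL ht (by linarith) hx
  rw [M1, hwE, hvE]
  exact (h.isTame hM).norm_sub_averaged_le ha (ae_kernelMeasure_abs_le _) hw hv (by linarith)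
    ⟨by linarith, htT⟩

lemma norm_M1_sub_le (h : d.Assumptions M C₁) (hM : 0 ≤ M) {l : ℕ} (hl : 1 ≤ l) (hlL : l < d.L)
    {t : ℝ} (ht : 0 ≤ t) (htT : t + d.step l ≤ d.T) {x y : V} (hx : x ∈ d.S) (hy : y ∈ d.S) :
    ‖d.M1 l t x - d.M1 l t y‖ ≤ d.η l * d.ε * avgLipConst M d.T * ‖x - y‖ := by
  have hs := h.step_pos l
  have := h.kernel.isProbabilityMeasure
  have ha : 0 ≤ d.η l * d.ε := (mul_pos (h.η_pos l hl hlL) h.ε_pos).le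
  obtain ⟨w, hw, hwE⟩ := h.exists_solution ht (by linarith) hx
  obtain ⟨v, hv, hvE⟩ := h.exists_averaged_solution hl hlL ht (by linarith) hx
  obtain ⟨w₂, hw₂, hwE₂⟩ := h.exists_solution ht (by linarith) hy
  obtain ⟨v₂, hv₂, hvE₂⟩ := h.exists_averaged_solution hl hlL ht (by linarith) hy
  rw [M1, M1, hwE, hvE, hwE₂, hvE₂]
  exact (h.isTame hM).norm_averagingError_sub_le ha (ae_kernelMeasure_abs_le _) hw hv hw₂ hv₂
    (by linarith) ⟨by linarith, htT⟩

lemma K_nonneg (h : d.Assumptions M C₁) {l : ℕ} (hl : 1 ≤ l) (hlL : l < d.L) : 0 ≤ d.K l := by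
  refine Real.sSup_nonneg ?_
  rintro _ ⟨ω, hω, rfl⟩
  exact mul_nonneg (abs_nonneg _) (h.κ_nonneg l hl hlL ω hω)

lemma norm_M0_le (h : d.Assumptions M C₁) {l : ℕ} (hl : 1 ≤ l) (hlL : l < d.L)
    {t : ℝ} (ht : 0 ≤ t) (htT : t + d.step l ≤ d.T) {x : V} (hx : x ∈ d.S) :
    ‖d.M0 l t x‖ ≤ C₁ * (d.step l ^ (d.p + 1) * d.K l) := by
  have hs := h.step_pos l
  calc ‖d.M0 l t x‖ ≤ d.Cbar l * d.step l ^ (d.p + 1) := (h.truncation l hl hlL).1 t ht htT x hx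
    _ ≤ C₁ * d.K l * d.step l ^ (d.p + 1) := by
      have := h.Cbar_le l hl hlL
      gcongr
    _ = _ := by ring

/-- The size of the truncation error says nothing about its variation in the state; the expansion
does. It is subtracted termwise, and `step ^ (p + 1)` is factored out of the Lipschitz constants. -/
lemma norm_M0_sub_le (h : d.Assumptions M C₁) {l : ℕ} (hl : 1 ≤ l) (hlL : l < d.L)
    {t : ℝ} (ht : 0 ≤ t) (htT : t + d.step l ≤ d.T) {x y : V} (hx : x ∈ d.S) (hy : y ∈ d.S) :
    ‖d.M0 l t x - d.M0 l t y‖ ≤ C₁ * (d.step l ^ (d.p + 1) * d.K l) * ‖x - y‖ := by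
  have hs := h.step_pos l
  obtain ⟨-, coef, lam, hsum, hle, hc⟩ := h.truncation l hl hlL
  obtain ⟨hlip, hexp⟩ := hc t ht htT
  have h1 := (hexp x hx).sub (hexp y hy)
  have h2 : HasSum (fun j => d.step l ^ (d.p + 1) * (lam j * d.step l ^ j) * ‖x - y‖)
      (d.step l ^ (d.p + 1) * (∑' j, lam j * d.step l ^ j) * ‖x - y‖) :=
    (hsum.hasSum.mul_left _).mul_right _
  have h3 : ‖d.M0 l t x - d.M0 l t y‖ ≤
      d.step l ^ (d.p + 1) * (∑' j, lam j * d.step l ^ j) * ‖x - y‖ := by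
    rw [← h1.tsum_eq]
    refine tsum_of_norm_bounded h2 fun j => ?_
    rw [← smul_sub, norm_smul, Real.norm_of_nonneg (by positivity), pow_add]
    have := mul_le_mul_of_nonneg_left (hlip j x hx y hy)
      (by positivity : 0 ≤ d.step l ^ (d.p + 1) * d.step l ^ j)
    linarith
  refine h3.trans ?_
  have h4 := hle.trans (h.Cbar_le l hl hlL)
  calc _ ≤ d.step l ^ (d.p + 1) * (C₁ * d.K l) * ‖x - y‖ := by gcongr
    _ = _ := by ring

lemma norm_M1_le_normM1 (h : d.Assumptions M C₁) (hM : 0 ≤ M) {l : ℕ} (hl : 1 ≤ l)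
    (hlL : l < d.L) {t : ℝ} (ht : 0 ≤ t) (htT : t + d.step l ≤ d.T) {x : V} (hx : x ∈ d.S) :
    ‖d.M1 l t x‖ ≤ d.η l * d.ε * d.normM1 := by
  have hpos : 0 < d.η l * d.ε := mul_pos (h.η_pos l hl hlL) h.ε_pos
  rw [mul_comm, ← div_le_iff₀ hpos]
  -- Boundedness must be shown: `sSup` of an unbounded set of reals is `0`.
  refine le_csSup ⟨avgConst M d.T, ?_⟩ ⟨l, t, x, hl, hlL, ht, htT, hx, rfl⟩
  rintro _ ⟨l, t, x, hl, hlL, ht, htT, hx, rfl⟩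
  have hpos : 0 < d.η l * d.ε := mul_pos (h.η_pos l hl hlL) h.ε_pos
  rw [div_le_iff₀ hpos, mul_comm]
  exact h.norm_M1_le hM hl hlL ht htT hx

lemma norm_M0_le_normM0 (h : d.Assumptions M C₁) (hC₁ : 0 ≤ C₁) {l : ℕ} (hl : 1 ≤ l)
    (hlL : l < d.L) {t : ℝ} (ht : 0 ≤ t) (htT : t + d.step l ≤ d.T) {x : V} (hx : x ∈ d.S) :
    ‖d.M0 l t x‖ ≤ d.step l ^ (d.p + 1) * d.K l * d.normM0 := by
  have hbd := h.norm_M0_le hl hlL ht htT hx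
  have hs := h.step_pos l
  -- If `K l = 0`, the quotient in `normM0` is `0` by convention and carries no information, but
  -- then the truncation error itself vanishes.
  rcases (h.K_nonneg hl hlL).eq_or_lt with h0 | hK
  · rw [← h0] at hbd ⊢
    simpa using hbd
  have hpos : 0 < d.step l ^ (d.p + 1) * d.K l := by positivity
  rw [mul_comm, ← div_le_iff₀ hpos]
  refine le_csSup ⟨C₁, ?_⟩ ⟨l, t, x, hl, hlL, ht, htT, hx, rfl⟩
  rintro _ ⟨l, t, x, hl, hlL, ht, htT, hx, rfl⟩
  have hs := h.step_pos l
  have hK := h.K_nonneg hl hlL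
  exact div_le_of_le_mul₀ (by positivity) hC₁ (h.norm_M0_le hl hlL ht htT hx)

lemma normM1_nonneg (h : d.Assumptions M C₁) : 0 ≤ d.normM1 := by
  refine Real.sSup_nonneg ?_
  rintro _ ⟨l, t, x, hl, hlL, ht, htT, hx, rfl⟩
  have := h.η_pos l hl hlL
  have := h.ε_pos
  positivity

lemma normM0_nonneg (h : d.Assumptions M C₁) : 0 ≤ d.normM0 := by
  refine Real.sSup_nonneg ?_
  rintro _ ⟨l, t, x, hl, hlL, ht, htT, hx, rfl⟩
  have := h.step_pos l
  have := h.K_nonneg hl hlL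
  positivity

lemma alpha_nonneg (h : d.Assumptions M C₁) {C : ℝ} (hC : 0 ≤ C) {l : ℕ} (hl : 1 ≤ l)
    (hlL : l < d.L) : 0 ≤ d.alpha C l := by
  have := h.η_pos l hl hlL
  have := h.ε_pos
  have := h.step_pos l
  have := h.K_nonneg hl hlL
  rw [alpha]; positivity

lemma gamma_nonneg (h : d.Assumptions M C₁) {C : ℝ} (hC : 0 ≤ C) {l : ℕ} (hl : 1 ≤ l)
    (hlL : l < d.L) : 0 ≤ d.gamma C l := by
  have := h.η_pos l hl hlL
  have := h.ε_pos
  have := h.step_pos l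
  have := h.K_nonneg hl hlL
  have := h.normM0_nonneg
  have := h.normM1_nonneg
  rw [gamma]; positivity

lemma one_le_beta (h : d.Assumptions M C₁) {l : ℕ} (hl : 1 ≤ l) (hlL : l < d.L) :
    1 ≤ d.beta l := by
  have := h.C₂_nonneg l hl hlL
  have := h.step_pos l
  rw [beta]
  have : 0 ≤ d.C₂ l * d.step l := by positivity
  linarith

lemma delta0_nonneg (h : d.Assumptions M C₁) {C : ℝ} (hC : 0 ≤ C) : 0 ≤ d.delta0 C := by
  have := h.c_nonneg
  have := h.step_pos 1
  have := h.step_pos 0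
  rw [delta0]; positivity

/-- The exact propagator follows every solution. -/
lemma E_eq_of_isSolution (h : d.Assumptions M C₁) (hM : 0 ≤ M) {t r : ℝ} {x : V} {w : ℝ → V}
    (hw : IsSolution (modulationRHS d.Lop d.Nl d.ε) d.D t d.T x w) (hr : 0 ≤ r)
    (hrT : t + r ≤ d.T) : d.E t r x = w (t + r) := by
  obtain ⟨v, hv, hvE⟩ := exists_solution_exactProp ⟨w, hw⟩
  have := hv.norm_sub_le hM (fun s x hx y hy => (h.isTame hM).lipschitz s hx hy) hw (t + r)
    ⟨by linarith, hrT⟩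
  rw [sub_self, norm_zero, zero_mul] at this
  rw [E, hvE]
  exact sub_eq_zero.1 (norm_le_zero_iff.1 this)

/-- `E` chooses a solution afresh for each start, so the flow property rests on uniqueness, through
`E_eq_of_isSolution`. -/
lemma E_add (h : d.Assumptions M C₁) (hM : 0 ≤ M) {t r r' : ℝ} (ht : 0 ≤ t) {x : V}
    (hx : x ∈ d.S) (hr : 0 ≤ r) (hr' : 0 ≤ r') (hT : t + r + r' ≤ d.T) :
    d.E t (r + r') x = d.E (t + r) r' (d.E t r x) := by
  obtain ⟨w, hw, hwE⟩ := h.exists_solution ht (by linarith) hx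
  rw [hwE, hwE, h.E_eq_of_isSolution hM (hw.restrict (by linarith)) hr' hT, add_assoc]

/-- The serial fine propagator. -/
lemma norm_E_sub_P_zero_le (h : d.Assumptions M C₁) (hM : 0 ≤ M) {C : ℝ}
    (hC : Real.exp (M * d.T) ≤ C) {t : ℝ} (ht : 0 ≤ t) (htT : t + d.N * d.step 0 ≤ d.T) {x : V}
    (hrun : d.RunIn 0 t x) : ‖d.E t (d.step 1) x - d.P 0 t x‖ ≤ d.delta0 C := by
  have hs := h.step_pos 0
  have hc := h.c_nonneg
  have hrun' : ∀ n < d.N, serialSteps (d.G 0) (d.step 0) t x n ∈ d.S := hrun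
  have hx : x ∈ d.S := hrun' 0 h.N_pos
  have hNs : 0 ≤ (d.N : ℝ) * d.step 0 := by positivity
  have hT : 0 ≤ d.T := by linarith
  obtain ⟨w, hw, hwE⟩ := h.exists_solution ht (by linarith) hx
  have key := le_of_growth_recursion (q := Real.exp (M * d.step 0)) (N := d.N)
    (e := fun n => ‖w (t + n * d.step 0) - serialSteps (d.G 0) (d.step 0) t x n‖)
    (δ := d.c * d.step 0 ^ (d.p₀ + 1)) (Real.one_le_exp (by positivity)) (by positivity)
    (by simp [serialSteps, hw.1]) ?_ d.N le_rfl
  · have hE : d.E t (d.step 1) x = w (t + d.N * d.step 0) := by rw [hwE, step_succ]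
    rw [hE]
    refine key.trans ?_
    have h1 : Real.exp (M * d.step 0) ^ d.N ≤ C := by
      rw [← Real.exp_nat_mul]
      refine le_trans (Real.exp_le_exp.2 ?_) hC
      have := mul_le_mul_of_nonneg_left (by linarith : (d.N : ℝ) * d.step 0 ≤ d.T) hM
      linarith
    calc _ ≤ (d.N : ℝ) * (d.c * d.step 0 ^ (d.p₀ + 1)) * C := by gcongr
      _ = d.delta0 C := by rw [delta0, step_succ]; ring
  · intro n hn
    have hn1 : ((n : ℝ) + 1) * d.step 0 ≤ d.N * d.step 0 := by
      have : ((n : ℝ) + 1) ≤ d.N := by exact_mod_cast hn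
      gcongr
    have hns : 0 ≤ (n : ℝ) * d.step 0 := by positivity
    set y := serialSteps (d.G 0) (d.step 0) t x n with hy
    have hyS : y ∈ d.S := hrun' n hn
    -- The exact flow is restarted from the numerical state `y`: earlier errors are carried on by
    -- the exact flow, at rate `exp (M * step 0)`, and stability of the level `0` scheme is not
    -- needed.
    obtain ⟨v, hv, hvE⟩ := h.exists_solution (t := t + n * d.step 0) (by linarith) (by linarith) hyS
    have h1 := (hw.restrict (t' := t + n * d.step 0) (by linarith)).norm_sub_le hM
      (fun s x hx y hy => (h.isTame hM).lipschitz s hx hy) hv (t + n * d.step 0 + d.step 0)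
      ⟨by linarith, by linarith⟩
    have h2 := h.fine (t + n * d.step 0) (by linarith) (by linarith) y hyS
    rw [hvE] at h2
    have e1 : t + ((n + 1 : ℕ) : ℝ) * d.step 0 = t + n * d.step 0 + d.step 0 := by
      push_cast; ring
    have e2 : t + n * d.step 0 + d.step 0 - (t + n * d.step 0) = d.step 0 := by ring
    have e3 : serialSteps (d.G 0) (d.step 0) t x (n + 1) = d.G 0 (t + n * d.step 0) y := rfl
    rw [e2] at h1
    rw [e1, e3]
    have h3 := norm_sub_le_norm_sub_add_norm_sub (w (t + n * d.step 0 + d.step 0))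
      (v (t + n * d.step 0 + d.step 0)) (d.G 0 (t + n * d.step 0) y)
    linarith

end Assumptions

end Data

/-! ### Induction over the levels -/

namespace Data

variable {V : Type*} [NormedAddCommGroup V] [InnerProductSpace ℝ V]

/-- The bound for the error on level `l` after `n` steps. -/
noncomputable def errorBound (d : Data V) (C : ℝ) (α₀ : ℕ → ℝ) (l n : ℕ) : ℝ :=
  (∑ j ∈ Finset.Icc 1 l, d.levelError C j (if j = l then n else d.N)
    * ∏ i ∈ Finset.Icc (j + 1) l, d.amp α₀ i) + d.delta0 C * ∏ i ∈ Finset.Icc 1 l, d.amp α₀ i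

lemma errorBound_zero (d : Data V) (C : ℝ) (α₀ : ℕ → ℝ) (n : ℕ) :
    d.errorBound C α₀ 0 n = d.delta0 C := by
  simp [errorBound]

/-- Horner form of the sum of products, which makes the induction over levels possible. Only the top
level stops after `n` steps; the finer ones always run all `N`. -/
lemma errorBound_succ (d : Data V) (C : ℝ) (α₀ : ℕ → ℝ) (l n : ℕ) :
    d.errorBound C α₀ (l + 1) n =
      d.levelError C (l + 1) n + d.errorBound C α₀ l d.N * d.amp α₀ (l + 1) := by
  rw [errorBound, errorBound, Finset.sum_Icc_succ_top (by omega),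
    Finset.prod_Icc_succ_top (a := 1) (b := l) (by omega)]
  have h1 : ∑ j ∈ Finset.Icc 1 l, d.levelError C j (if j = l + 1 then n else d.N)
      * ∏ i ∈ Finset.Icc (j + 1) (l + 1), d.amp α₀ i =
      (∑ j ∈ Finset.Icc 1 l, d.levelError C j (if j = l then d.N else d.N)
      * ∏ i ∈ Finset.Icc (j + 1) l, d.amp α₀ i) * d.amp α₀ (l + 1) := by
    rw [Finset.sum_mul]
    refine Finset.sum_congr rfl fun j hj => ?_
    have hj := (Finset.mem_Icc.1 hj).2
    rw [if_neg (by omega), ite_self, Finset.prod_Icc_succ_top (by omega), mul_assoc]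
  rw [h1]
  simp only [if_true, Finset.Icc_eq_empty (by omega : ¬ l + 1 + 1 ≤ l + 1), Finset.prod_empty]
  ring

/-- The constant `C` dominates all constants of the continuous problem. -/
structure Dominates (d : Data V) (M C₁ C : ℝ) : Prop where
  one_le : 1 ≤ C
  exp_le : Real.exp (M * d.T) ≤ C
  C₁_le : C₁ ≤ C
  avg_le : avgConst M d.T ≤ C
  avgLip_le : avgLipConst M d.T ≤ C

namespace Assumptions

variable [CompleteSpace V] {d : Data V} {M C₁ C : ℝ} {α₀ : ℕ → ℝ}

lemma levelError_nonneg (h : d.Assumptions M C₁) (hC : 0 ≤ C) {l : ℕ} (hl : 1 ≤ l)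
    (hlL : l < d.L) (n : ℕ) : 0 ≤ d.levelError C l n := by
  have := h.gamma_nonneg hC hl hlL
  have := h.alpha_nonneg hC hl hlL
  have := zero_le_one.trans (h.one_le_beta hl hlL)
  rw [levelError]; positivity

lemma errorBound_nonneg (h : d.Assumptions M C₁) (hC : 0 ≤ C)
    (hα₀ : ∀ l, 1 ≤ l → l < d.L → 0 ≤ α₀ l) (l : ℕ) (hlL : l < d.L) (n : ℕ) :
    0 ≤ d.errorBound C α₀ l n := by
  induction l generalizing n with
  | zero => rw [errorBound_zero]; exact h.delta0_nonneg hC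
  | succ l ih =>
    have h1 := h.levelError_nonneg hC (by omega) hlL n
    have h2 := ih (by omega) d.N
    have h3 := zero_le_one.trans (h.one_le_beta (by omega) hlL)
    have h4 := hα₀ (l + 1) (by omega) hlL
    have h5 : 0 ≤ d.amp α₀ (l + 1) := by rw [amp]; positivity
    rw [errorBound_succ]
    positivity

/-- The error of one coarse step is Lipschitz continuous with constant `ᾱ_l`. -/
lemma norm_E_sub_G_sub_le (h : d.Assumptions M C₁) (hM : 0 ≤ M) (hC : Dominates d M C₁ C)
    {l : ℕ} (hl : 1 ≤ l) (hlL : l < d.L) {t : ℝ} (ht : 0 ≤ t) (htT : t + d.step l ≤ d.T)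
    {x y : V} (hx : x ∈ d.S) (hy : y ∈ d.S) :
    ‖(d.E t (d.step l) x - d.G l t x) - (d.E t (d.step l) y - d.G l t y)‖ ≤
      d.alpha C l * ‖x - y‖ := by
  have h1 := h.norm_M1_sub_le hM hl hlL ht htT hx hy
  have h2 := h.norm_M0_sub_le hl hlL ht htT hx hy
  have e : (d.E t (d.step l) x - d.G l t x) - (d.E t (d.step l) y - d.G l t y) =
      (d.M1 l t x - d.M1 l t y) + (d.M0 l t x - d.M0 l t y) := by
    rw [M1, M1, M0, M0]; abel
  have hη := h.η_pos l hl hlL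
  have hε := h.ε_pos
  have hs := h.step_pos l
  have hK := h.K_nonneg hl hlL
  have h3 : d.η l * d.ε * avgLipConst M d.T * ‖x - y‖ ≤ d.η l * d.ε * C * ‖x - y‖ := by
    have := hC.avgLip_le
    gcongr
  have h4 : C₁ * (d.step l ^ (d.p + 1) * d.K l) * ‖x - y‖ ≤
      C * (d.step l ^ (d.p + 1) * d.K l) * ‖x - y‖ := by
    have := hC.C₁_le
    gcongr
  rw [e, alpha]
  refine (norm_add_le _ _).trans ?_
  linarith

/-- The error of one coarse step is at most `γ̄_l`. -/
lemma norm_E_sub_G_le (h : d.Assumptions M C₁) (hM : 0 ≤ M) (hC₁ : 0 ≤ C₁)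
    (hC : Dominates d M C₁ C) {l : ℕ} (hl : 1 ≤ l) (hlL : l < d.L) {t : ℝ} (ht : 0 ≤ t)
    (htT : t + d.step l ≤ d.T) {x : V} (hx : x ∈ d.S) :
    ‖d.E t (d.step l) x - d.G l t x‖ ≤ d.gamma C l := by
  have h1 := h.norm_M1_le_normM1 hM hl hlL ht htT hx
  have h2 := h.norm_M0_le_normM0 hC₁ hl hlL ht htT hx
  have e : d.E t (d.step l) x - d.G l t x = d.M1 l t x + d.M0 l t x := by
    rw [M1, M0]; abel
  have h3 := le_mul_of_one_le_left ((norm_nonneg _).trans h1) hC.one_le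
  have h4 := le_mul_of_one_le_left ((norm_nonneg _).trans h2) hC.one_le
  rw [e, gamma]
  refine (norm_add_le _ _).trans ?_
  linarith

/-- The error on level `l + 1`, given the error of the fine propagator `P^l`. -/
lemma norm_E_sub_U_le (h : d.Assumptions M C₁) (hM : 0 ≤ M) (hC₁ : 0 ≤ C₁)
    (hC : Dominates d M C₁ C) {l : ℕ} (hlL : l + 1 < d.L) {δ : ℝ} (hδ : 0 ≤ δ)
    (hP : ∀ t x, 0 ≤ t → t + d.step (l + 1) ≤ d.T → d.RunIn l t x →
      ‖d.E t (d.step (l + 1)) x - d.P l t x‖ ≤ δ)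
    {t : ℝ} (ht : 0 ≤ t) (htT : t + d.N * d.step (l + 1) ≤ d.T) {x : V}
    (hrun : d.RunIn (l + 1) t x) {n : ℕ} (hn : n ≤ d.N) :
    ‖d.E t (n * d.step (l + 1)) x - d.U (l + 1) t x (d.k (l + 1)) n‖ ≤
      d.levelError C (l + 1) n + δ * (d.beta (l + 1) ^ (d.N - 1) *
        ∑ i ∈ Finset.range d.N, (1 + d.alpha C (l + 1)) ^ i) := by
  have hl : 1 ≤ l + 1 := by omega
  have hs := h.step_pos (l + 1)
  have hC0 : 0 ≤ C := zero_le_one.trans hC.one_le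
  have hα := h.alpha_nonneg hC0 hl hlL
  have hβ := h.one_le_beta hl hlL
  have hγ := h.gamma_nonneg hC0 hl hlL
  have hβ0 : 0 ≤ d.beta (l + 1) := zero_le_one.trans hβ
  have hrun' : ∀ n < d.N, d.E t (n * d.step (l + 1)) x ∈ d.S ∧
      (∀ j ≤ d.k (l + 1), d.U (l + 1) t x j n ∈ d.S) ∧
      ∀ j < d.k (l + 1), RunIn d l (t + n * d.step (l + 1)) (d.U (l + 1) t x j n) := hrun
  have hx : x ∈ d.S := by
    have := (hrun' 0 h.N_pos).2.1 0 (Nat.zero_le _)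
    rwa [U_zero] at this
  have htime : ∀ n < d.N, 0 ≤ t + n * d.step (l + 1) ∧
      t + n * d.step (l + 1) + d.step (l + 1) ≤ d.T := by
    intro n hn
    have h1 : ((n : ℝ) + 1) * d.step (l + 1) ≤ d.N * d.step (l + 1) := by
      have : ((n : ℝ) + 1) ≤ d.N := by exact_mod_cast hn
      gcongr
    exact ⟨by positivity, by linarith⟩
  have hE : ∀ n < d.N, d.E t ((n + 1 : ℕ) * d.step (l + 1)) x =
      d.E (t + n * d.step (l + 1)) (d.step (l + 1)) (d.E t (n * d.step (l + 1)) x) := by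
    intro n hn
    have e : ((n + 1 : ℕ) : ℝ) * d.step (l + 1) = n * d.step (l + 1) + d.step (l + 1) := by
      push_cast; ring
    rw [e]
    exact h.E_add hM ht hx (by positivity) hs.le (htime n hn).2
  have key := le_of_parareal_recursion (N := d.N) (k := d.k (l + 1))
    (e := fun j n => ‖d.E t (n * d.step (l + 1)) x - d.U (l + 1) t x j n‖) hα hβ hγ hδ
    (fun j _ => by simp [U_zero, E, exactProp_zero]) ?_ ?_ n hn (d.k (l + 1)) le_rfl
  -- Only the binomial keeps `n`; the other occurrences are enlarged to `N`.
  · refine key.trans (add_le_add ?_ ?_)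
    · rw [levelError]
      have := pow_le_pow_right₀ hβ (by omega : n - d.k (l + 1) - 1 ≤ d.N - d.k (l + 1) - 1)
      gcongr
    · have := pow_le_pow_right₀ hβ (by omega : n - 1 ≤ d.N - 1)
      gcongr
  · intro n hn
    obtain ⟨t0, t1⟩ := htime n hn
    obtain ⟨m1, m2, -⟩ := hrun' n hn
    have m3 := m2 0 (Nat.zero_le _)
    simp only [hE n hn, U_succ_zero_left]
    have h1 := h.norm_E_sub_G_le hM hC₁ hC hl hlL t0 t1 m1
    have h2 := h.stability (l + 1) hl hlL _ t0 t1 _ m1 _ m3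
    refine (norm_sub_le_norm_sub_add_norm_sub _
      (d.G (l + 1) (t + n * d.step (l + 1)) (d.E t (n * d.step (l + 1)) x)) _).trans ?_
    rw [beta]
    linarith
  · intro n hn j hj
    obtain ⟨t0, t1⟩ := htime n hn
    obtain ⟨m1, m2, m3⟩ := hrun' n hn
    have m4 := m2 j hj.le
    have m5 := m2 (j + 1) hj
    simp only [hE n hn, U_succ_succ]
    set s := t + n * d.step (l + 1)
    set y := d.E t (n * d.step (l + 1)) x
    set u := d.U (l + 1) t x j n
    set v := d.U (l + 1) t x (j + 1) n
    have h1 := h.norm_E_sub_G_sub_le hM hC hl hlL t0 t1 m1 m4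
    have h2 := h.stability (l + 1) hl hlL _ t0 t1 _ m1 _ m5
    have h3 := hP s u t0 t1 (m3 j hj)
    -- The Parareal cancellation: the coarse error `E - G` enters only through its difference at `y`
    -- and `u` (factor `α`), `G` is compared at `y` and `v` (factor `β`), and the fine error is
    -- taken at the old iterate `u` (the term `δ`).
    have e : d.E s (d.step (l + 1)) y - (d.G (l + 1) s v + d.P l s u - d.G (l + 1) s u) =
        ((d.E s (d.step (l + 1)) y - d.G (l + 1) s y) -
          (d.E s (d.step (l + 1)) u - d.G (l + 1) s u)) +
        (d.G (l + 1) s y - d.G (l + 1) s v) + (d.E s (d.step (l + 1)) u - d.P l s u) := by abel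
    rw [e, beta]
    refine norm_add₃_le.trans ?_
    linarith

/-- The error of the propagator `P^l`. -/
lemma norm_E_sub_P_le (h : d.Assumptions M C₁) (hM : 0 ≤ M) (hC₁ : 0 ≤ C₁)
    (hC : Dominates d M C₁ C) (hα₀ : ∀ l, 1 ≤ l → l < d.L → 0 ≤ α₀ l)
    (hsum : ∀ l, 1 ≤ l → l < d.L →
      d.N * (1 + α₀ l) ^ (d.N - 1) = ∑ i ∈ Finset.range d.N, (1 + d.alpha C l) ^ i)
    (l : ℕ) (hlL : l < d.L) :
    ∀ t x, 0 ≤ t → t + d.step (l + 1) ≤ d.T → d.RunIn l t x →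
      ‖d.E t (d.step (l + 1)) x - d.P l t x‖ ≤ d.errorBound C α₀ l d.N := by
  induction l with
  | zero =>
    intro t x ht htT hrun
    rw [step_succ] at htT
    rw [errorBound_zero]
    exact h.norm_E_sub_P_zero_le hM hC.exp_le ht htT hrun
  | succ l ih =>
    intro t x ht htT hrun
    rw [step_succ] at htT ⊢
    rw [P_succ, errorBound_succ]
    refine (h.norm_E_sub_U_le hM hC₁ hC hlL (h.errorBound_nonneg (zero_le_one.trans hC.one_le) hα₀ l
      (by omega) d.N) (ih (by omega)) ht htT hrun le_rfl).trans (le_of_eq ?_)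
    rw [← hsum (l + 1) (by omega) hlL, amp]
    ring

end Assumptions

end Data

end MLParareal

/-! ### Assembly of the theorem -/

theorem mainTheorem4 {V : Type*} [NormedAddCommGroup V] [InnerProductSpace ℝ V] [CompleteSpace V]
    (M T C₁ : ℝ) (hM : 0 ≤ M) (hT : 0 < T) (hC₁ : 0 ≤ C₁) :
    ∃ C : ℝ, 0 < C ∧ ∀ d : MLParareal.Data V, d.T = T → d.Assumptions M C₁ →
      (∀ l, 1 ≤ l → l < d.L → ∀ t, 0 ≤ t → t + d.step l ≤ T → ∀ x ∈ d.S, ∀ y ∈ d.S,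
        ‖d.M1 l t x‖ ≤ C * d.η l * d.ε ∧
        ‖d.M1 l t x - d.M1 l t y‖ ≤ C * d.η l * d.ε * ‖x - y‖) ∧
      ∃ α₀ : ℕ → ℝ,
        (∀ l, 1 ≤ l → l < d.L → α₀ l ∈ Set.Icc 0 (d.alpha C l) ∧
          (1 + d.alpha C l) ^ d.N - 1 = d.N * d.alpha C l * (1 + α₀ l) ^ (d.N - 1)) ∧
        ∀ l, 1 ≤ l → l < d.L → ∀ t x, 0 ≤ t → t + d.N * d.step l ≤ T → d.RunIn l t x →
          ∀ n ≤ d.N,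
            ‖d.E t (n * d.step l) x - d.U l t x (d.k l) n‖ ≤
              (∑ j ∈ Finset.Icc 1 l,
                  d.levelError C j (if j = l then n else d.N)
                    * ∏ i ∈ Finset.Icc (j + 1) l, d.amp α₀ i)
                + d.delta0 C * ∏ i ∈ Finset.Icc 1 l, d.amp α₀ i := by
  have hA := MLParareal.avgConst_nonneg hM hT.le
  have hB := MLParareal.avgLipConst_nonneg hM hT.le
  have hexp := Real.exp_pos (M * T)
  -- A sum of nonnegative terms dominates each of them. The summand `1` serves `γ̄_l`, where `C`
  -- multiplies suprema that already bound the errors.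
  set C := 1 + Real.exp (M * T) + C₁ + MLParareal.avgConst M T +
    MLParareal.avgLipConst M T
  refine ⟨C, by positivity, ?_⟩
  rintro d rfl h
  have hC : MLParareal.Data.Dominates d M C₁ C :=
    ⟨by linarith, by linarith, by linarith, by linarith, by linarith⟩
  have hC0 : 0 ≤ C := zero_le_one.trans hC.one_le
  refine ⟨fun l hl hlL t ht htT x hx y hy => ?_, ?_⟩
  · have hη := h.η_pos l hl hlL
    have hε := h.ε_pos
    have h1 := hC.avg_le
    have h2 := hC.avgLip_le
    constructor
    · calc _ ≤ d.η l * d.ε * MLParareal.avgConst M d.T := h.norm_M1_le hM hl hlL ht htT hx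
        _ ≤ d.η l * d.ε * C := by gcongr
        _ = _ := by ring
    · calc _ ≤ d.η l * d.ε * MLParareal.avgLipConst M d.T * ‖x - y‖ :=
            h.norm_M1_sub_le hM hl hlL ht htT hx hy
        _ ≤ d.η l * d.ε * C * ‖x - y‖ := by gcongr
        _ = _ := by ring
  -- `α₀` is defined by the geometric sum. The identity in the statement is this equation multiplied
  -- by `alpha`, and would not determine the sum when `alpha = 0`.
  · have hex : ∀ l, ∃ α₀, 1 ≤ l → l < d.L → α₀ ∈ Set.Icc 0 (d.alpha C l) ∧
        d.N * (1 + α₀) ^ (d.N - 1) = ∑ i ∈ Finset.range d.N, (1 + d.alpha C l) ^ i := by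
      intro l
      by_cases hl : 1 ≤ l ∧ l < d.L
      · obtain ⟨α₀, h1, h2⟩ := MLParareal.exists_geom_sum_eq (h.alpha_nonneg hC0 hl.1 hl.2) d.N
        exact ⟨α₀, fun _ _ => ⟨h1, h2⟩⟩
      · exact ⟨0, fun h1 h2 => absurd ⟨h1, h2⟩ hl⟩
    choose α₀ hα₀ using hex
    have hnn : ∀ l, 1 ≤ l → l < d.L → 0 ≤ α₀ l := fun l h1 h2 => (hα₀ l h1 h2).1.1
    have hsum := fun l h1 h2 => (hα₀ l h1 h2).2
    refine ⟨α₀, fun l hl hlL => ⟨(hα₀ l hl hlL).1, ?_⟩, ?_⟩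
    · have h1 := mul_geom_sum (1 + d.alpha C l) d.N
      rw [← hsum l hl hlL, add_sub_cancel_left] at h1
      rw [← h1]
      ring
    · intro l hl hlL t x ht htT hrun n hn
      obtain ⟨l, rfl⟩ : ∃ m, l = m + 1 := ⟨l - 1, by omega⟩
      refine (h.norm_E_sub_U_le hM hC₁ hC hlL (h.errorBound_nonneg hC0 hnn l (by omega) d.N)
        (h.norm_E_sub_P_le hM hC₁ hC hnn hsum l (by omega)) ht htT hrun hn).trans (le_of_eq ?_)
      have := d.errorBound_succ C α₀ l n
      rw [MLParareal.Data.errorBound] at this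
      rw [this, ← hsum (l + 1) hl hlL, MLParareal.Data.amp]
      ring
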